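/- All graphs are finite and simple. For graphs $G$ and $H$, $G\cup H$ denotes the disjoint union, $kH$ the disjoint union of $k$ copies of $H$, and $G\vee H$ the join (the disjoint union together with all edges between $G$ and $H$); $K_m$ and $I_m$ are the complete and the edgeless graph on $m$ vertices. A graph $G$ is $H$-saturated if it has no subgraph isomorphic to $H$, but for every pair of distinct non-adjacent vertices $u,v$ of $G$ the graph $G+uv$ has a subgraph isomorphic to $H$. Let $\mathrm{sat}(n,H)$ be the minimum number of edges of an $H$-saturated graph on $n$ vertices, and let $\mathrm{Sat}(n,H)$ be the family of all $H$-saturated graphs with $n$ vertices and $\mathrm{sat}(n,H)$ edges. **Theorem.** Let $p,q,t,n$ be integers with $2\le p\le q$, $t\ge 2$ and $n>q(q+1)(t-1)+3(p-2)$. Then, up to isomorphism, $$\mathrm{Sat}\bigl(n,\,K_p\cup (t-1)K_q\bigr)=\bigl\{\,K_{p-2}\vee\bigl((t-1)K_{q+1}\cup I_{n-t+3-p-q(t-1)}\bigr)\bigr\}.$$ That is, a graph $G$ belongs to $\mathrm{Sat}(n,K_p\cup(t-1)K_q)$ if and only if it is isomorphic to $K_{p-2}\vee\bigl((t-1)K_{q+1}\cup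 I_{n-t+3-p-q(t-1)}\bigr)$. -/

import Mathlib

namespace CliqueSat

open SimpleGraph

/-- `kH`: the disjoint union of `k` copies of the graph `H`. -/
def copies (k : ℕ) {W : Type*} (H : SimpleGraph W) : SimpleGraph (Fin k × W) where
  Adj x y := x.1 = y.1 ∧ H.Adj x.2 y.2
  symm.symm _ _ h := ⟨h.1.symm, h.2.symm⟩
  loopless.irrefl _ h := H.irrefl h.2

/-- `G ∨ H`: the join, i.e. the disjoint union of `G` and `H` together with all edges between
the two parts. -/
def join {V W : Type*} (G : SimpleGraph V) (H : SimpleGraph W) : SimpleGraph (V ⊕ W) where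
  Adj
    | Sum.inl u, Sum.inl v => G.Adj u v
    | Sum.inr u, Sum.inr v => H.Adj u v
    | _, _ => True
  symm.symm
    | Sum.inl _, Sum.inl _ => fun h => h.symm
    | Sum.inr _, Sum.inr _ => fun h => h.symm
    | Sum.inl _, Sum.inr _ => fun h => h
    | Sum.inr _, Sum.inl _ => fun h => h
  loopless.irrefl
    | Sum.inl _ => fun h => G.irrefl h
    | Sum.inr _ => fun h => H.irrefl h

/-- `G` is `H`-saturated: `G` has no subgraph isomorphic to `H`, but for every edge `uv` of the
complement of `G`, the graph `G + uv` has one. -/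
def IsSaturated {V W : Type*} (H : SimpleGraph W) (G : SimpleGraph V) : Prop :=
  H.Free G ∧ ∀ u v : V, Gᶜ.Adj u v → H.IsContained (G ⊔ edge u v)

/-- The saturation number `sat(n, H)`: the minimum number of edges of an `H`-saturated graph on
`n` vertices. -/
noncomputable def sat (n : ℕ) {W : Type*} (H : SimpleGraph W) : ℕ :=
  sInf {m : ℕ | ∃ G : SimpleGraph (Fin n), IsSaturated H G ∧ G.edgeSet.ncard = m}

/-- `G ∈ Sat(n, H)`: `G` is an `H`-saturated graph on `n` vertices with `sat(n, H)` edges. -/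
def IsMinSaturated (n : ℕ) {V W : Type*} (H : SimpleGraph W) (G : SimpleGraph V) : Prop :=
  Finite V ∧ Nat.card V = n ∧ IsSaturated H G ∧ G.edgeSet.ncard = sat n H

/-- `K_p ∪ k K_q`. -/
def cliqueUnion (p k q : ℕ) : SimpleGraph (Fin p ⊕ Fin k × Fin q) :=
  completeGraph (Fin p) ⊕g copies k (completeGraph (Fin q))

/-- `K_a ∨ (k K_b ∪ I_c)`. -/
def joinGraph (a k b c : ℕ) : SimpleGraph (Fin a ⊕ (Fin k × Fin b ⊕ Fin c)) :=
  join (completeGraph (Fin a))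
    (copies k (completeGraph (Fin b)) ⊕g (⊥ : SimpleGraph (Fin c)))

end CliqueSat

/-!
Write `D = p - 2`, `k = t - 1`. The join graph `K_D ∨ (k K_{q+1} ∪ I_c)` is saturated by a counting
argument (`IsExtremal.isSaturated`), so the theorem amounts to showing that every saturated graph
`G` on `n` vertices has at least as many edges, with equality only for the join graph
(`IsSaturated.sum_degree`). Edges are counted through degree sums.

Two non-adjacent vertices of `G` have `D` pairwise adjacent common neighbours, hence the minimum
degree is at least `D`. If it is larger, double counting the edges around a vertex of minimum
degree gives too many edges (`IsSaturated.lt_sum_degree`); this is where `n` has to be large.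
Otherwise a vertex `v` has degree `D`, its neighbourhood `S` is a clique joined to everything, and
the graph `G'` obtained by isolating `S` is critical (`IsSaturated.isCritical`): every vertex is
missed by some `k` disjoint `q`-cliques, and `k` disjoint `q`-cliques always meet every edge.

The core of the proof is the bound `∑ deg ≥ k q (q + 1)` for critical graphs, with equality only for
forests of copies of `K_{q+1}` glued along single vertices (`IsCritical.sum_degree`). In a critical
graph every vertex that is not isolated has degree at least `q`, and for `q ≥ 3` the closed
neighbourhood of a vertex of degree `q` is a `(q + 1)`-clique, called a block here. Either some block
`A` has a vertex `a` such that no packing has two members meeting `A.erase a`; then isolating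
`A.erase a` leaves a critical graph for `k - 1`, and induction applies. Or each block has two
vertices that lie in a `q`-clique mostly outside the block and therefore have large degree;
discharging the deficiency of the vertices of degree `q` to them shows that the average degree of the
vertices that are not isolated is at least `q + 1` (`IsCritical.mul_card_le_sum_degree`), and there
are more than `q k` such vertices. For `q = 2` criticality alone does not suffice, as a 5-cycle
shows, but then `p = 2` and saturation makes adjacency transitive by Gallai's argument
(`IsCritical.trans`).

Finally, saturation rules out two cliques of the forest sharing a vertex
(`IsSaturated.disjoint_of_isCliqueForest`).
-/

namespace CliqueSat

open SimpleGraph Finset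

section Critical

open scoped Classical

variable {V : Type*} {G : SimpleGraph V} {q k : ℕ} {P : Finset (Finset V)} {A s : Finset V}

/-! ### Packings of cliques -/

/-- `P` consists of `k` pairwise disjoint cliques of `G`, each with `q` vertices. -/
structure IsPacking (G : SimpleGraph V) (q k : ℕ) (P : Finset (Finset V)) : Prop where
  clique : ∀ s ∈ P, G.IsNClique q s
  disj : ∀ s ∈ P, ∀ t ∈ P, s ≠ t → Disjoint s t
  card : P.card = k

namespace IsPacking

theorem eq_of_mem (h : IsPacking G q k P) {s t : Finset V} (hs : s ∈ P) (ht : t ∈ P) {x : V}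
    (hxs : x ∈ s) (hxt : x ∈ t) : s = t := by
  by_contra hst
  exact Finset.disjoint_left.1 (h.disj s hs t ht hst) hxs hxt

theorem erase (h : IsPacking G q k P) (hs : s ∈ P) : IsPacking G q (k - 1) (P.erase s) where
  clique t ht := h.clique t (mem_of_mem_erase ht)
  disj t ht u hu := h.disj t (mem_of_mem_erase ht) u (mem_of_mem_erase hu)
  card := by rw [card_erase_of_mem hs, h.card]

theorem insert (h : IsPacking G q k P) (hq : 0 < q) (hs : G.IsNClique q s)
    (hd : ∀ t ∈ P, Disjoint s t) : IsPacking G q (k + 1) (insert s P) where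
  clique t ht := by
    rcases mem_insert.1 ht with rfl | ht
    · exact hs
    · exact h.clique t ht
  disj t ht u hu htu := by
    rcases mem_insert.1 ht with hts | htP <;> rcases mem_insert.1 hu with hus | huP
    · exact absurd (hts.trans hus.symm) htu
    · exact hts ▸ hd u huP
    · exact hus ▸ (hd t htP).symm
    · exact h.disj t htP u huP htu
  card := by
    rw [card_insert_of_notMem, h.card]
    intro hsP
    have : s = ∅ := by simpa using hd s hsP
    have h2 := hs.card_eq
    rw [this, card_empty] at h2
    omega

theorem replace (h : IsPacking G q k P) (hq : 0 < q) {s' : Finset V} (hs : s ∈ P)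
    (hs' : G.IsNClique q s') (hd : ∀ t ∈ P, t ≠ s → Disjoint s' t) :
    IsPacking G q k (Insert.insert s' (P.erase s)) := by
  have hk : k - 1 + 1 = k := by
    have := card_pos.2 ⟨s, hs⟩
    rw [h.card] at this
    omega
  have := (h.erase hs).insert hq hs' fun t ht => hd t (mem_of_mem_erase ht) (ne_of_mem_erase ht)
  rwa [hk] at this

end IsPacking

/-- Every vertex is missed by some packing of `k` `q`-cliques, and each such packing meets every
edge. For `q ≥ 2` this makes `k` the maximum number of disjoint `q`-cliques. -/
structure IsCritical (G : SimpleGraph V) (q k : ℕ) : Prop where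
  avoid : ∀ u, ∃ P, IsPacking G q k P ∧ ∀ s ∈ P, u ∉ s
  cover : ∀ P, IsPacking G q k P → ∀ x y, G.Adj x y → ∃ s ∈ P, x ∈ s ∨ y ∈ s

/-- If a packing misses `w`, it covers every neighbour of `w`. -/
theorem IsCritical.exists_mem (h : IsCritical G q k) (hP : IsPacking G q k P) {u w : V}
    (huw : G.Adj u w) (hw : ∀ s ∈ P, w ∉ s) : ∃ s ∈ P, u ∈ s := by
  obtain ⟨s, hs, hu | hu⟩ := h.cover P hP u w huw
  · exact ⟨s, hs, hu⟩
  · exact absurd hu (hw s hs)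

/-- Every edge `uw` gives a `q`-clique through `u` that avoids `w`. -/
theorem IsCritical.exists_clique (h : IsCritical G q k) {u w : V} (huw : G.Adj u w) :
    ∃ s, G.IsNClique q s ∧ u ∈ s ∧ w ∉ s := by
  obtain ⟨P, hP, hw⟩ := h.avoid w
  obtain ⟨s, hs, hu⟩ := h.exists_mem hP huw hw
  exact ⟨s, hP.clique s hs, hu, hw s hs⟩

/-! ### Isolating a set of vertices -/

/-- `G` with all edges that meet `T` removed. -/
def isolate (G : SimpleGraph V) (T : Finset V) : SimpleGraph V where
  Adj x y := G.Adj x y ∧ x ∉ T ∧ y ∉ T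
  symm.symm _ _ h := ⟨h.1.symm, h.2.2, h.2.1⟩
  loopless.irrefl _ h := G.irrefl h.1

@[simp] theorem isolate_adj {T : Finset V} {x y : V} :
    (isolate G T).Adj x y ↔ G.Adj x y ∧ x ∉ T ∧ y ∉ T := Iff.rfl

theorem isClique_of_isolate {T : Finset V} (h : (isolate G T).IsClique (s : Set V)) :
    G.IsClique (s : Set V) := fun _ hx _ hy hxy => (h hx hy hxy).1

theorem disjoint_of_isolate {T : Finset V} (h : (isolate G T).IsClique (s : Set V))
    (hs : 2 ≤ s.card) : Disjoint s T := by
  rw [Finset.disjoint_left]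
  intro x hx
  obtain ⟨y, hy, hxy⟩ := exists_mem_ne (by omega : 1 < s.card) x
  exact (h hx hy hxy.symm).2.1

theorem isClique_isolate {T : Finset V} (h : G.IsClique (s : Set V)) (hd : Disjoint s T) :
    (isolate G T).IsClique (s : Set V) := fun _ hx _ hy hxy =>
  ⟨h hx hy hxy, Finset.disjoint_left.1 hd hx, Finset.disjoint_left.1 hd hy⟩

/-- If no packing has two members that meet `A.erase a`, where `A` is a `(q + 1)`-clique, then
isolating `A.erase a` preserves criticality, with one clique fewer in the packings. -/
theorem IsCritical.isolate (h : IsCritical G q k) (hq : 2 ≤ q) (hk : 0 < k) {a : V}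
    (hA : G.IsNClique (q + 1) A) (ha : a ∈ A)
    (h1 : ∀ P, IsPacking G q k P → ∀ s ∈ P, ∀ t ∈ P, s ≠ t →
      Disjoint s (A.erase a) ∨ Disjoint t (A.erase a)) :
    IsCritical (isolate G (A.erase a)) q (k - 1) where
  avoid u := by
    obtain ⟨P, hP, hu⟩ := h.avoid u
    obtain ⟨s, hs, hd⟩ : ∃ s ∈ P, ∀ t ∈ P, t ≠ s → Disjoint t (A.erase a) := by
      by_cases hc : ∃ s ∈ P, ¬ Disjoint s (A.erase a)
      · obtain ⟨s, hs, hsA⟩ := hc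
        exact ⟨s, hs, fun t ht hts => (h1 P hP t ht s hs hts).resolve_right hsA⟩
      · push Not at hc
        obtain ⟨s, hs⟩ := card_pos.1 (by rw [hP.card]; exact hk)
        exact ⟨s, hs, fun t ht _ => hc t ht⟩
    have hE := hP.erase hs
    refine ⟨P.erase s, ⟨fun t ht => ⟨?_, (hE.clique t ht).card_eq⟩, hE.disj, hE.card⟩,
      fun t ht => hu t (mem_of_mem_erase ht)⟩
    exact isClique_isolate (hE.clique t ht).isClique
      (hd t (mem_of_mem_erase ht) (ne_of_mem_erase ht))
  cover P hP x y hxy := by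
    have hP' : IsPacking G q (k - 1) P :=
      ⟨fun t ht => ⟨isClique_of_isolate (hP.clique t ht).isClique, (hP.clique t ht).card_eq⟩,
        hP.disj, hP.card⟩
    have hB : G.IsNClique q (A.erase a) :=
      ⟨hA.isClique.subset (by simp), by
        rw [card_erase_of_mem ha, hA.card_eq]; rfl⟩
    have hI := hP'.insert (by omega) hB fun t ht =>
      (disjoint_of_isolate (hP.clique t ht).isClique
        (by rw [(hP.clique t ht).card_eq]; exact hq)).symm
    rw [Nat.sub_add_cancel hk] at hI
    obtain ⟨s, hs, hxs⟩ := h.cover _ hI x y hxy.1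
    rcases mem_insert.1 hs with rfl | hs
    · rcases hxs with hxs | hxs
      · exact absurd hxs hxy.2.1
      · exact absurd hxs hxy.2.2
    · exact ⟨s, hs, hxs⟩

/-! ### Closed neighbourhoods and blocks -/

variable [Fintype V]

/-- The closed neighbourhood of `u`. -/
noncomputable def closedNbhd (G : SimpleGraph V) (u : V) : Finset V :=
  insert u (G.neighborFinset u)

theorem mem_closedNbhd {u v : V} : v ∈ closedNbhd G u ↔ v = u ∨ G.Adj u v := by
  simp [closedNbhd]

theorem self_mem_closedNbhd {u : V} : u ∈ closedNbhd G u := mem_closedNbhd.2 (Or.inl rfl)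

theorem card_closedNbhd (G : SimpleGraph V) (u : V) :
    (closedNbhd G u).card = G.degree u + 1 := by
  rw [closedNbhd, card_insert_of_notMem (by simp), card_neighborFinset_eq_degree]

theorem subset_closedNbhd (hs : G.IsClique (s : Set V)) {u : V} (hu : u ∈ s) :
    s ⊆ closedNbhd G u := by
  intro v hv
  by_cases h : v = u
  · exact mem_closedNbhd.2 (Or.inl h)
  · exact mem_closedNbhd.2 (Or.inr (hs hu hv (Ne.symm h)))

theorem IsCritical.le_degree (h : IsCritical G q k) {u w : V} (huw : G.Adj u w) :
    q ≤ G.degree u := by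
  obtain ⟨s, hs, hu, hw⟩ := h.exists_clique huw
  have h1 : insert w s ⊆ closedNbhd G u :=
    insert_subset (mem_closedNbhd.2 (Or.inr huw)) (subset_closedNbhd hs.isClique hu)
  have h2 := card_le_card h1
  rw [card_insert_of_notMem hw, card_closedNbhd, hs.card_eq] at h2
  omega

/-- For `q ≥ 3`, two neighbours of a vertex `u` of degree `q` are adjacent: a `q`-clique through
`u` that avoids a third neighbour contains both of them. -/
theorem IsCritical.isClique_closedNbhd (h : IsCritical G q k) (hq : 3 ≤ q) {u : V}
    (hu : G.degree u = q) : G.IsClique (closedNbhd G u : Set V) := by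
  intro x hx y hy hxy
  rw [mem_coe, mem_closedNbhd] at hx hy
  rcases hx with rfl | hx
  · rcases hy with rfl | hy
    · exact absurd rfl hxy
    · exact hy
  rcases hy with rfl | hy
  · exact hx.symm
  obtain ⟨w, hw, hwx⟩ : ∃ w ∈ G.neighborFinset u, w ∉ ({x, y} : Finset V) := by
    apply exists_mem_notMem_of_card_lt_card
    rw [card_neighborFinset_eq_degree, hu]
    exact lt_of_le_of_lt card_le_two (by omega)
  rw [mem_neighborFinset] at hw
  obtain ⟨s, hs, hus, hws⟩ := h.exists_clique hw
  have hsub : s ⊆ (closedNbhd G u).erase w := fun v hv =>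
    mem_erase.2 ⟨fun e => hws (e ▸ hv), subset_closedNbhd hs.isClique hus hv⟩
  have heq : s = (closedNbhd G u).erase w := by
    apply eq_of_subset_of_card_le hsub
    rw [card_erase_of_mem (mem_closedNbhd.2 (Or.inr hw)), card_closedNbhd, hs.card_eq, hu]
    rfl
  simp only [mem_insert, Finset.mem_singleton, not_or] at hwx
  apply hs.isClique _ _ hxy
  · rw [heq]; simp [mem_closedNbhd, hx, Ne.symm hwx.1]
  · rw [heq]; simp [mem_closedNbhd, hy, Ne.symm hwx.2]

/-- A block is a `(q + 1)`-clique that is the closed neighbourhood of one of its vertices. -/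
structure IsBlock (G : SimpleGraph V) (q : ℕ) (A : Finset V) : Prop where
  clique : G.IsNClique (q + 1) A
  exists_low : ∃ u ∈ A, G.degree u = q

/-- The vertices of degree `q` in `A`. -/
noncomputable def lowVertices (G : SimpleGraph V) (q : ℕ) (A : Finset V) : Finset V :=
  A.filter fun u => G.degree u = q

theorem mem_low {u : V} : u ∈ lowVertices G q A ↔ u ∈ A ∧ G.degree u = q := by simp [lowVertices]

theorem lowVertices_subset : lowVertices G q A ⊆ A := filter_subset _ _

theorem IsBlock.eq_closedNbhd (hA : IsBlock G q A) {u : V} (hu : u ∈ lowVertices G q A) :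
    A = closedNbhd G u := by
  rw [mem_low] at hu
  apply eq_of_subset_of_card_le (subset_closedNbhd hA.clique.isClique hu.1)
  rw [card_closedNbhd, hA.clique.card_eq, hu.2]

theorem IsBlock.subset (hA : IsBlock G q A) {u : V} (hu : u ∈ lowVertices G q A)
    (hs : G.IsClique (s : Set V)) (hus : u ∈ s) : s ⊆ A := by
  rw [hA.eq_closedNbhd hu]
  exact subset_closedNbhd hs hus

theorem IsBlock.low_nonempty (hA : IsBlock G q A) : (lowVertices G q A).Nonempty := by
  obtain ⟨u, hu⟩ := hA.exists_low
  exact ⟨u, mem_low.2 hu⟩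

/-- A vertex of degree `q` lies in only one block. -/
theorem IsBlock.eq_of_low_mem {A' : Finset V} (hA : IsBlock G q A) (hA' : IsBlock G q A')
    {u : V} (hu : u ∈ lowVertices G q A) (hu' : u ∈ A') : A = A' := by
  rw [hA.eq_closedNbhd hu, hA'.eq_closedNbhd (mem_low.2 ⟨hu', (mem_low.1 hu).2⟩)]

/-- Adjacent vertices of degree `q` lie in the same block. -/
theorem IsBlock.eq_of_adj {A' : Finset V} (hA : IsBlock G q A) (hA' : IsBlock G q A')
    {u v : V} (hu : u ∈ lowVertices G q A) (hv : v ∈ lowVertices G q A') (huv : G.Adj u v) : A = A' := by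
  refine (hA'.eq_of_low_mem hA hv ?_).symm
  rw [hA.eq_closedNbhd hu]
  exact mem_closedNbhd.2 (Or.inr huv)

/-- If a block has two vertices of degree `q`, then every packing covers one of them, by a
`q`-clique inside the block. -/
theorem IsCritical.exists_mem_subset (h : IsCritical G q k) (hP : IsPacking G q k P)
    (hA : IsBlock G q A) (h2 : 2 ≤ (lowVertices G q A).card) :
    ∃ s ∈ P, s ⊆ A ∧ ∃ u ∈ lowVertices G q A, u ∈ s := by
  obtain ⟨x, hx, y, hy, hxy⟩ := one_lt_card.1 h2
  obtain ⟨s, hs, hxs | hys⟩ := h.cover P hP x y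
    (hA.clique.isClique (mem_low.1 hx).1 (mem_low.1 hy).1 hxy)
  · exact ⟨s, hs, hA.subset hx (hP.clique s hs).isClique hxs, x, hx, hxs⟩
  · exact ⟨s, hs, hA.subset hy (hP.clique s hs).isClique hys, y, hy, hys⟩

/-- A packing that misses a vertex `x` of degree `q` of a block contains the block minus `x`, if
the block has a further vertex of degree `q`. -/
theorem IsCritical.erase_mem (h : IsCritical G q k) (hP : IsPacking G q k P)
    (hA : IsBlock G q A) (h2 : 2 ≤ (lowVertices G q A).card) {x : V} (hx : x ∈ lowVertices G q A)
    (hxP : ∀ s ∈ P, x ∉ s) : A.erase x ∈ P := by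
  obtain ⟨s, hs, hsA, -⟩ := h.exists_mem_subset hP hA h2
  have : s = A.erase x := by
    apply eq_of_subset_of_card_le
    · exact fun v hv => mem_erase.2 ⟨fun e => hxP s hs (e ▸ hv), hsA hv⟩
    · rw [card_erase_of_mem (mem_low.1 hx).1, hA.clique.card_eq, (hP.clique s hs).card_eq]; rfl
  exact this ▸ hs

/-! ### Intersections of blocks -/

/-- Two blocks with at least two vertices of degree `q` each share at most one vertex. -/
theorem IsCritical.card_inter_le_one (h : IsCritical G q k) {A' : Finset V}
    (hA : IsBlock G q A) (hA' : IsBlock G q A') (hne : A ≠ A') (h2 : 2 ≤ (lowVertices G q A).card)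
    (h2' : 2 ≤ (lowVertices G q A').card) : (A ∩ A').card ≤ 1 := by
  obtain ⟨x, hx⟩ := hA.low_nonempty
  obtain ⟨P, hP, hxP⟩ := h.avoid x
  have hs := h.erase_mem hP hA h2 hx hxP
  obtain ⟨t, ht, htA', w, hw, hwt⟩ := h.exists_mem_subset hP hA' h2'
  have hd : Disjoint (A.erase x) t := by
    apply hP.disj _ hs _ ht
    rintro rfl
    exact hne (hA'.eq_of_low_mem hA hw (mem_of_mem_erase hwt)).symm
  have hsub : A ∩ A' ⊆ A' \ t := by
    intro v hv
    rw [mem_inter] at hv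
    refine mem_sdiff.2 ⟨hv.2, fun hvt => Finset.disjoint_left.1 hd (mem_erase.2 ⟨?_, hv.1⟩) hvt⟩
    rintro rfl
    exact hne (hA.eq_of_low_mem hA' hx hv.2)
  have := card_le_card hsub
  rw [card_sdiff_of_subset htA', hA'.clique.card_eq, (hP.clique t ht).card_eq] at this
  omega

/-- For `q = 3`, a block with at least two vertices of degree `q` shares at most one vertex with a
block that has a single vertex `u` of degree `q`: otherwise, in a packing that misses a vertex `x`
of degree `q` of the first block `A`, the member `A.erase x` can be replaced by `u` together with
the common vertices, and an edge inside `A` is missed. -/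
theorem IsCritical.card_inter_le_one_of_three (h : IsCritical G 3 k) {A' : Finset V}
    (hA : IsBlock G 3 A) (hA' : IsBlock G 3 A') (hne : A ≠ A') (h2 : 2 ≤ (lowVertices G 3 A).card) :
    (A ∩ A').card ≤ 1 := by
  by_contra hc
  have hdis : Disjoint (A ∩ A') (lowVertices G 3 A) := by
    rw [Finset.disjoint_left]
    intro v hv hv'
    exact hne (hA.eq_of_low_mem hA' hv' (mem_inter.1 hv).2)
  have hcard : (A ∩ A').card = 2 := by
    have h1 := card_le_card (union_subset (inter_subset_left (s₁ := A) (s₂ := A'))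
      (lowVertices_subset (G := G) (q := 3)))
    rw [card_union_of_disjoint hdis, hA.clique.card_eq] at h1
    omega
  obtain ⟨x, hx, y, hy, hxy⟩ := one_lt_card.1 h2
  obtain ⟨P, hP, hxP⟩ := h.avoid x
  have hs := h.erase_mem hP hA h2 hx hxP
  obtain ⟨u, hu⟩ := hA'.low_nonempty
  have huA : u ∉ A := fun hu' => hne (hA'.eq_of_low_mem hA hu hu').symm
  have hsub : A ∩ A' ⊆ A.erase x := by
    intro v hv
    refine mem_erase.2 ⟨?_, (mem_inter.1 hv).1⟩
    rintro rfl
    exact Finset.disjoint_left.1 hdis hv hx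
  have huP : ∀ t ∈ P, u ∉ t := by
    intro t ht hut
    have htA' := hA'.subset hu (hP.clique t ht).isClique hut
    have hd : Disjoint (A.erase x) t := by
      apply hP.disj _ hs _ ht
      rintro rfl
      exact huA (mem_of_mem_erase hut)
    have := card_le_card (union_subset (inter_subset_right (s₁ := A) (s₂ := A')) htA')
    rw [card_union_of_disjoint (disjoint_of_subset_left hsub hd), hA'.clique.card_eq, hcard,
      (hP.clique t ht).card_eq] at this
    omega
  have hnew : G.IsNClique 3 (insert u (A ∩ A')) := by
    refine ⟨hA'.clique.isClique.subset ?_, ?_⟩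
    · rw [coe_subset]
      exact insert_subset (mem_low.1 hu).1 inter_subset_right
    · rw [card_insert_of_notMem fun hu' => huA (mem_inter.1 hu').1, hcard]
  have hP' := hP.replace (by norm_num) hs hnew (by
    intro t ht htne
    rw [disjoint_insert_left]
    exact ⟨huP t ht, disjoint_of_subset_left hsub (hP.disj _ hs _ ht htne.symm)⟩)
  obtain ⟨t, ht, hxt⟩ := h.cover _ hP' x y
    (hA.clique.isClique (mem_low.1 hx).1 (mem_low.1 hy).1 hxy)
  have key : ∀ z ∈ lowVertices G 3 A, z ∉ insert u (A ∩ A') := by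
    intro z hz hz'
    rcases mem_insert.1 hz' with rfl | hz'
    · exact huA (mem_low.1 hz).1
    · exact Finset.disjoint_left.1 hdis hz' hz
  rcases mem_insert.1 ht with rfl | ht
  · exact hxt.elim (key x hx) (key y hy)
  · rcases hxt with hxt | hyt
    · exact hxP t (mem_of_mem_erase ht) hxt
    · exact ne_of_mem_erase ht (hP.eq_of_mem (mem_of_mem_erase ht) hs hyt
        (mem_erase.2 ⟨hxy.symm, (mem_low.1 hy).1⟩))

end Critical

section Discharging

open scoped Classical

variable {V : Type*} [Fintype V] {G : SimpleGraph V} {q k : ℕ} {P : Finset (Finset V)}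
  {A : Finset V} {a b : V}

/-! ### Paying vertices of a block -/

/-- The vertices of a block `A` that pay for the vertices of degree `q` in `A`: those that lie in a
`q`-clique with few vertices in `A`, hence with many outside. "Few" means one vertex if `A`
has two vertices of degree `q`, and at most `q - 2` otherwise. -/
noncomputable def payers (G : SimpleGraph V) (q : ℕ) (A : Finset V) : Finset V :=
  A.filter fun b => ∃ R, G.IsNClique q R ∧ b ∈ R ∧
    (R ∩ A).card ≤ if 2 ≤ (lowVertices G q A).card then 1 else q - 2

theorem mem_payers : b ∈ payers G q A ↔ b ∈ A ∧ ∃ R, G.IsNClique q R ∧ b ∈ R ∧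
    (R ∩ A).card ≤ if 2 ≤ (lowVertices G q A).card then 1 else q - 2 := by
  simp [payers]

theorem IsBlock.disjoint_payers (hA : IsBlock G q A) (hq : 2 ≤ q) :
    Disjoint (payers G q A) (lowVertices G q A) := by
  rw [Finset.disjoint_left]
  intro b hb hb'
  obtain ⟨-, R, hR, hbR, hc⟩ := mem_payers.1 hb
  rw [inter_eq_left.2 (hA.subset hb' hR.isClique hbR), hR.card_eq] at hc
  split_ifs at hc <;> omega

theorem IsBlock.card_payers_add_card_lowVertices (hA : IsBlock G q A) (hq : 2 ≤ q) :
    (payers G q A).card + (lowVertices G q A).card ≤ q + 1 := by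
  rw [← card_union_of_disjoint (hA.disjoint_payers hq), ← hA.clique.card_eq]
  exact card_le_card (union_subset (filter_subset _ _) lowVertices_subset)

theorem IsCritical.lt_degree_of_mem_payers (h : IsCritical G q k) (hA : IsBlock G q A)
    (hq : 2 ≤ q) (hb : b ∈ payers G q A) : q + 1 ≤ G.degree b := by
  have hbA := (mem_payers.1 hb).1
  have h1 : G.degree b ≠ q := fun e =>
    Finset.disjoint_left.1 (hA.disjoint_payers hq) hb (mem_low.2 ⟨hbA, e⟩)
  obtain ⟨u, hu⟩ := hA.low_nonempty
  have hub : u ≠ b := by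
    rintro rfl
    exact h1 (mem_low.1 hu).2
  have := h.le_degree (hA.clique.isClique hbA (mem_low.1 hu).1 hub.symm)
  omega

/-- In a block whose only paying vertex is `a`, at most one member of a packing meets the
vertices other than `a`. -/
theorem IsCritical.disjoint_or_disjoint (h : IsCritical G q k) (hA : IsBlock G q A)
    (hq : 3 ≤ q ∨ 2 ≤ (lowVertices G q A).card) (ha : payers G q A ⊆ {a})
    (hP : IsPacking G q k P) {s t : Finset V} (hs : s ∈ P) (ht : t ∈ P) (hst : s ≠ t) :
    Disjoint s (A.erase a) ∨ Disjoint t (A.erase a) := by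
  by_contra hc
  push Not at hc
  -- A member that meets `A.erase a` has more than "few" vertices in `A`.
  have many : ∀ r ∈ P, ¬ Disjoint r (A.erase a) →
      (if 2 ≤ (lowVertices G q A).card then 1 else q - 2) < (r ∩ A).card := by
    intro r hr hrA
    obtain ⟨y, hyr, hyA⟩ := Finset.not_disjoint_iff.1 hrA
    by_contra hle
    have := ha (mem_payers.2 ⟨mem_of_mem_erase hyA, r, hP.clique r hr, hyr, not_lt.1 hle⟩)
    exact ne_of_mem_erase hyA (Finset.mem_singleton.1 this)
  have hs1 := many s hs hc.1
  have ht1 := many t ht hc.2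
  by_cases hex : ∃ r ∈ P, r ⊆ A
  · obtain ⟨r, hr, hrA⟩ := hex
    have few : ∀ r' ∈ P, r' ≠ r → (r' ∩ A).card ≤ 1 := by
      intro r' hr' hne
      have hsub : r' ∩ A ⊆ A \ r := fun v hv => mem_sdiff.2 ⟨(mem_inter.1 hv).2,
        Finset.disjoint_left.1 (hP.disj r' hr' r hr hne) (mem_inter.1 hv).1⟩
      have := card_le_card hsub
      rw [card_sdiff_of_subset hrA, hA.clique.card_eq, (hP.clique r hr).card_eq] at this
      omega
    have hle : 1 ≤ if 2 ≤ (lowVertices G q A).card then 1 else q - 2 := by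
      split_ifs with h2
      · exact le_rfl
      · have := hq.resolve_right h2
        omega
    by_cases hsr : s = r
    · have := few t ht fun e => hst (hsr.trans e.symm)
      omega
    · have := few s hs hsr
      omega
  · have h2 : ¬ 2 ≤ (lowVertices G q A).card := by
      intro h2
      obtain ⟨r, hr, hrA, -⟩ := h.exists_mem_subset hP hA h2
      exact hex ⟨r, hr, hrA⟩
    rw [if_neg h2] at hs1 ht1
    have hq3 := hq.resolve_right h2
    obtain ⟨u, hu⟩ := hA.low_nonempty
    have huP : ∀ r ∈ P, u ∉ r := fun r hr hur =>
      hex ⟨r, hr, hA.subset hu (hP.clique r hr).isClique hur⟩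
    have hsub : s ∩ A ∪ t ∩ A ⊆ A.erase u := by
      intro v hv
      rw [mem_union, mem_inter, mem_inter] at hv
      refine mem_erase.2 ⟨?_, by tauto⟩
      rintro rfl
      rcases hv with hv | hv
      · exact huP s hs hv.1
      · exact huP t ht hv.1
    have := card_le_card hsub
    rw [card_union_of_disjoint, card_erase_of_mem (mem_low.1 hu).1, hA.clique.card_eq] at this
    · omega
    · exact disjoint_of_subset_left inter_subset_left
        (disjoint_of_subset_right inter_subset_left (hP.disj s hs t ht hst))

/-! ### The discharging argument -/

theorem IsBlock.mem_neighborFinset (hA : IsBlock G q A) {u : V} (hu : u ∈ A) (hb : b ∈ A)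
    (hub : u ≠ b) : u ∈ G.neighborFinset b := by
  rw [SimpleGraph.mem_neighborFinset]
  exact hA.clique.isClique hb hu hub.symm

/-- A vertex of degree at least `q + 1` can afford to pay `(q - 1) / 2` to each block with at least two
vertices of degree `q`, and `1 / 2` to each other block, for which it is a paying vertex, out of
the excess of its degree over `q + 1`. -/
theorem IsCritical.pay_le (h : IsCritical G q k) (hq : 3 ≤ q) (hb : q + 1 ≤ G.degree b)
    {B₁ B₂ : Finset (Finset V)} (hB₁ : ∀ A ∈ B₁, IsBlock G q A ∧ b ∈ payers G q A ∧
      ¬ 2 ≤ (lowVertices G q A).card)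
    (hB₂ : ∀ A ∈ B₂, IsBlock G q A ∧ b ∈ payers G q A ∧ 2 ≤ (lowVertices G q A).card) :
    B₂.card * (q - 1) + B₁.card + 2 * (q + 1) ≤ 2 * G.degree b := by
  set T := B₁.biUnion (lowVertices G q) with hT
  have mem_of_payer : ∀ {A}, b ∈ payers G q A → b ∈ A := fun h => (mem_payers.1 h).1
  have hTc : T.card = B₁.card := by
    rw [hT, card_biUnion, card_eq_sum_ones]
    · refine sum_congr rfl fun A hA => ?_
      have := (hB₁ A hA).1.low_nonempty.card_pos
      have := (hB₁ A hA).2.2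
      omega
    · intro A hA A' hA' hne
      refine Finset.disjoint_left.2 fun v hv hv' => hne ?_
      exact (hB₁ A hA).1.eq_of_low_mem (hB₁ A' hA').1 hv (lowVertices_subset hv')
  have hTb : T ⊆ G.neighborFinset b := by
    intro u hu
    obtain ⟨A, hA, huA⟩ := mem_biUnion.1 hu
    refine (hB₁ A hA).1.mem_neighborFinset (mem_low.1 huA).1 (mem_of_payer (hB₁ A hA).2.1) ?_
    rintro rfl
    have := (mem_low.1 huA).2
    omega
  have hTcl : T ⊆ closedNbhd G b := hTb.trans (subset_insert _ _)
  -- The vertices of degree `q` in different blocks are pairwise non-adjacent.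
  have hTR : ∀ R : Finset V, G.IsClique (R : Set V) → (T ∩ R).card ≤ 1 := by
    intro R hR
    rw [card_le_one]
    intro x hx y hy
    rw [mem_inter] at hx hy
    obtain ⟨A, hA, hxA⟩ := mem_biUnion.1 hx.1
    obtain ⟨A', hA', hyA⟩ := mem_biUnion.1 hy.1
    by_contra hxy
    have := (hB₁ A hA).1.eq_of_adj (hB₁ A' hA').1 hxA hyA (hR hx.2 hy.2 hxy)
    subst this
    exact (hB₁ A hA).2.2 (one_lt_card.2 ⟨x, hxA, y, hyA, hxy⟩)
  have hcl : ∀ {A}, IsBlock G q A → b ∈ A → A ⊆ closedNbhd G b := fun hA hbA =>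
    subset_closedNbhd hA.clique.isClique hbA
  have hdeg := card_closedNbhd G b
  have hTA : ∀ A ∈ B₂, Disjoint T A := by
    intro A hA
    rw [Finset.disjoint_left]
    intro u hu huA
    obtain ⟨A', hA', huA'⟩ := mem_biUnion.1 hu
    have := (hB₁ A' hA').1.eq_of_low_mem (hB₂ A hA).1 huA' huA
    exact (hB₁ A' hA').2.2 (this ▸ (hB₂ A hA).2.2)
  rcases Nat.lt_or_ge 1 B₂.card with hr2 | hr2
  · -- The blocks of `B₂` share only `b`.
    have hU : (B₂.biUnion fun A => A.erase b).card = B₂.card * q := by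
      rw [card_biUnion, sum_const_nat]
      · intro A hA
        rw [card_erase_of_mem (mem_of_payer (hB₂ A hA).2.1), (hB₂ A hA).1.clique.card_eq]
        rfl
      · intro A hA A' hA' hne
        refine Finset.disjoint_left.2 fun v hv hv' => ?_
        have := h.card_inter_le_one (hB₂ A hA).1 (hB₂ A' hA').1 hne (hB₂ A hA).2.2
          (hB₂ A' hA').2.2
        rw [card_le_one] at this
        exact ne_of_mem_erase hv (this v (mem_inter.2 ⟨mem_of_mem_erase hv, mem_of_mem_erase hv'⟩)
          b (mem_inter.2 ⟨mem_of_payer (hB₂ A hA).2.1, mem_of_payer (hB₂ A' hA').2.1⟩))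
    have hUT : Disjoint (B₂.biUnion fun A => A.erase b) T := by
      rw [disjoint_biUnion_left]
      exact fun A hA => disjoint_of_subset_left (erase_subset _ _) (hTA A hA).symm
    have hUb : (B₂.biUnion fun A => A.erase b) ⊆ G.neighborFinset b := by
      intro u hu
      obtain ⟨A, hA, huA⟩ := mem_biUnion.1 hu
      exact (hB₂ A hA).1.mem_neighborFinset (mem_of_mem_erase huA)
        (mem_of_payer (hB₂ A hA).2.1) (ne_of_mem_erase huA)
    have hle := card_le_card (union_subset hUb hTb)
    rw [card_union_of_disjoint hUT, hU, hTc, card_neighborFinset_eq_degree] at hle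
    obtain ⟨m, rfl⟩ : ∃ m, q = m + 1 := ⟨q - 1, by omega⟩
    rw [Nat.add_sub_cancel]
    nlinarith
  rcases Nat.lt_or_ge 0 B₂.card with hr2' | hr2'
  · obtain ⟨A, hA⟩ := card_pos.1 hr2'
    obtain ⟨hAb, hbp, hAl⟩ := hB₂ A hA
    obtain ⟨hbA, R, hR, hbR, hRA⟩ := mem_payers.1 hbp
    rw [if_pos hAl] at hRA
    have hAR : (A ∪ R).card + (R ∩ A).card = q + 1 + q := by
      rw [inter_comm, card_union_add_card_inter, hAb.clique.card_eq, hR.card_eq]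
    have hTAR : (T ∩ (A ∪ R)).card ≤ 1 := by
      rw [inter_union_distrib_left, Finset.disjoint_iff_inter_eq_empty.1 (hTA A hA), empty_union]
      exact hTR R hR.isClique
    have hARcl : A ∪ R ⊆ closedNbhd G b :=
      union_subset (hcl hAb hbA) (subset_closedNbhd hR.isClique hbR)
    have h1 := card_le_card hARcl
    have h2 := card_le_card (union_subset hTcl hARcl)
    have h3 := card_union_add_card_inter T (A ∪ R)
    have h4 : B₂.card = 1 := by omega
    rw [h4, one_mul]
    by_cases hsmall : q = 3 ∧ B₁.card = 1
    · obtain ⟨rfl, hr1⟩ := hsmall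
      obtain ⟨A', hA'⟩ := card_pos.1 (by omega : 0 < B₁.card)
      obtain ⟨hAb', hbp', hAl'⟩ := hB₁ A' hA'
      have hi := h.card_inter_le_one_of_three hAb hAb' (by rintro rfl; exact hAl' hAl) hAl
      have h5 := card_le_card (union_subset (hcl hAb hbA) (hcl hAb' (mem_of_payer hbp')))
      have h6 := card_union_add_card_inter A A'
      rw [hAb.clique.card_eq, hAb'.clique.card_eq] at h6
      omega
    · omega
  · have h4 : B₂.card = 0 := by omega
    rw [h4, zero_mul]
    rcases Nat.eq_zero_or_pos B₁.card with hr1 | hr1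
    · omega
    obtain ⟨A, hA⟩ := card_pos.1 hr1
    obtain ⟨hAb, hbp, hAl⟩ := hB₁ A hA
    obtain ⟨hbA, R, hR, hbR, hRA⟩ := mem_payers.1 hbp
    rw [if_neg hAl] at hRA
    have hAR : (A ∪ R).card + (R ∩ A).card = q + 1 + q := by
      rw [inter_comm, card_union_add_card_inter, hAb.clique.card_eq, hR.card_eq]
    have hTAR : (T ∩ (A ∪ R)).card ≤ 2 := by
      rw [inter_union_distrib_left]
      exact (card_union_le _ _).trans
        (Nat.add_le_add (hTR A hAb.clique.isClique) (hTR R hR.isClique))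
    have hARcl : A ∪ R ⊆ closedNbhd G b :=
      union_subset (hcl hAb hbA) (subset_closedNbhd hR.isClique hbR)
    have h1 := card_le_card hARcl
    have h2 := card_le_card (union_subset hTcl hARcl)
    have h3 := card_union_add_card_inter T (A ∪ R)
    omega

/-- If every block has at least two paying vertices, the average degree of the vertices that are
not isolated is at least `q + 1`. -/
theorem IsCritical.mul_card_le_sum_degree (h : IsCritical G q k) (hq : 3 ≤ q)
    (hpay : ∀ A, IsBlock G q A → 2 ≤ (payers G q A).card) :
    (q + 1) * (univ.filter fun u => 0 < G.degree u).card ≤ ∑ u, G.degree u := by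
  set B : Finset (Finset V) := univ.filter (IsBlock G q) with hB
  have hBm : ∀ {A}, A ∈ B ↔ IsBlock G q A := by simp [hB]
  set L : Finset V := univ.filter fun u => G.degree u = q with hL
  set H : Finset V := univ.filter fun u => q + 1 ≤ G.degree u with hH
  have hLH : Disjoint L H := by
    rw [Finset.disjoint_left]
    intro u hu hu'
    simp only [hL, hH, mem_filter, mem_univ, true_and] at hu hu'
    omega
  have hW : (univ.filter fun u => 0 < G.degree u) ⊆ L ∪ H := by
    intro u hu
    simp only [hL, hH, mem_union, mem_filter, mem_univ, true_and] at hu ⊢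
    obtain ⟨w, hw⟩ := (G.degree_pos_iff_exists_adj u).1 hu
    have := h.le_degree hw
    omega
  set pay : Finset V → ℕ := fun A => if 2 ≤ (lowVertices G q A).card then q - 1 else 1 with hpayd
  have hLc : L.card ≤ ∑ A ∈ B, (lowVertices G q A).card := by
    refine le_trans (card_le_card fun u hu => ?_) card_biUnion_le
    have hu' : G.degree u = q := by simpa [hL] using hu
    refine mem_biUnion.2 ⟨closedNbhd G u, hBm.2 ⟨⟨h.isClique_closedNbhd hq hu', ?_⟩, u,
      self_mem_closedNbhd, hu'⟩, mem_low.2 ⟨self_mem_closedNbhd, hu'⟩⟩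
    rw [card_closedNbhd, hu']
  have h1 : 2 * L.card ≤ ∑ A ∈ B, ∑ b ∈ payers G q A, pay A := by
    refine (Nat.mul_le_mul_left 2 hLc).trans ?_
    rw [mul_sum]
    refine sum_le_sum fun A hA => ?_
    rw [sum_const, smul_eq_mul, hpayd]
    have hA' := hBm.1 hA
    have hp := hpay A hA'
    have := hA'.card_payers_add_card_lowVertices (by omega)
    dsimp only
    split_ifs with h2
    · exact Nat.mul_le_mul hp (by omega)
    · omega
  have h2 : ∑ A ∈ B, ∑ b ∈ payers G q A, pay A =
      ∑ b ∈ H, ∑ A ∈ B.filter (fun A => b ∈ payers G q A), pay A := by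
    apply sum_comm'
    intro A b
    simp only [mem_filter, hH, mem_univ, true_and]
    constructor
    · rintro ⟨hA, hb⟩
      exact ⟨⟨hA, hb⟩, h.lt_degree_of_mem_payers (hBm.1 hA) (by omega) hb⟩
    · exact fun hAb => hAb.1
  have h3 : ∀ b ∈ H, (∑ A ∈ B.filter (fun A => b ∈ payers G q A), pay A) + 2 * (q + 1) ≤
      2 * G.degree b := by
    intro b hb
    have hb' : q + 1 ≤ G.degree b := by simpa [hH] using hb
    have := h.pay_le hq hb'
      (B₁ := (B.filter fun A => b ∈ payers G q A).filter fun A => ¬ 2 ≤ (lowVertices G q A).card)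
      (B₂ := (B.filter fun A => b ∈ payers G q A).filter fun A => 2 ≤ (lowVertices G q A).card)
      (fun A hA => by
        simp only [mem_filter] at hA
        exact ⟨hBm.1 hA.1.1, hA.1.2, hA.2⟩)
      (fun A hA => by
        simp only [mem_filter] at hA
        exact ⟨hBm.1 hA.1.1, hA.1.2, hA.2⟩)
    rw [hpayd, sum_ite, sum_const, sum_const, smul_eq_mul, smul_eq_mul, mul_one]
    exact this
  have h4 := sum_le_sum h3
  rw [sum_add_distrib, ← h2, sum_const, smul_eq_mul, ← mul_sum] at h4
  have h5 : ∑ u ∈ L, G.degree u = L.card * q :=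
    sum_const_nat fun u hu => by simpa [hL] using hu
  have h6 : ∑ u ∈ L ∪ H, G.degree u ≤ ∑ u, G.degree u :=
    sum_le_univ_sum_of_nonneg fun _ => Nat.zero_le _
  rw [sum_union hLH, h5] at h6
  have h7 := card_le_card hW
  rw [card_union_of_disjoint hLH] at h7
  nlinarith [Nat.mul_le_mul_left (q + 1) h7]

/-- The same bound when no vertex has degree `q`. -/
theorem IsCritical.mul_card_le_sum_degree_of_ne (h : IsCritical G q k)
    (hne : ∀ u, G.degree u ≠ q) :
    (q + 1) * (univ.filter fun u => 0 < G.degree u).card ≤ ∑ u, G.degree u := by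
  refine le_trans ?_ (sum_le_univ_sum_of_nonneg (s := univ.filter fun u => 0 < G.degree u)
    fun _ => Nat.zero_le _)
  rw [mul_comm, ← smul_eq_mul]
  refine card_nsmul_le_sum _ _ _ fun u hu => ?_
  obtain ⟨w, hw⟩ := (G.degree_pos_iff_exists_adj u).1 (mem_filter.1 hu).2
  have := h.le_degree hw
  have := hne u
  omega

/-- If there is an edge, then more than `q * k` vertices are not isolated: a packing that misses
one of them covers `q * k` others. -/
theorem IsCritical.lt_card (h : IsCritical G q k) (hq : 2 ≤ q) {u w : V} (huw : G.Adj u w) :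
    q * k < (univ.filter fun u => 0 < G.degree u).card := by
  obtain ⟨P, hP, hu⟩ := h.avoid u
  have hc : (P.biUnion id).card = q * k := by
    rw [card_biUnion (t := id) fun s hs t ht hst => hP.disj s hs t ht hst, mul_comm, ← hP.card]
    exact sum_const_nat fun s hs => (hP.clique s hs).card_eq
  rw [← hc]
  apply card_lt_card
  rw [ssubset_iff_of_subset]
  · refine ⟨u, ?_, ?_⟩
    · simpa using (G.degree_pos_iff_exists_adj u).2 ⟨w, huw⟩
    · simpa using hu
  · intro x hx
    obtain ⟨s, hs, hxs⟩ := mem_biUnion.1 hx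
    obtain ⟨y, hy, hxy⟩ := exists_mem_ne (by rw [(hP.clique s hs).card_eq]; omega :
      1 < s.card) x
    simpa using (G.degree_pos_iff_exists_adj x).2
      ⟨y, (hP.clique s hs).isClique hxs hy hxy.symm⟩

end Discharging

section Forest

open scoped Classical

variable {V : Type*} {G : SimpleGraph V} {q k : ℕ} {A : Finset V} {a : V}

/-! ### Forests of cliques -/

/-- The edges of `G` are covered by the `k` members of `F`, cliques with `q + 1` vertices that are
glued along single vertices in a forest-like way. The last field records the consequence
that is needed: unless the members are pairwise disjoint, some member `A` meets another member `A'`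
but has only one vertex `a` in common with the others. -/
structure IsCliqueForest (G : SimpleGraph V) (q k : ℕ) (F : Finset (Finset V)) : Prop where
  card : F.card = k
  size : ∀ A ∈ F, A.card = q + 1
  adj : ∀ x y, G.Adj x y ↔ x ≠ y ∧ ∃ A ∈ F, x ∈ A ∧ y ∈ A
  exists_subset : ∀ s : Finset V, G.IsClique (s : Set V) → 2 ≤ s.card → ∃ A ∈ F, s ⊆ A
  leaf : (∀ A ∈ F, ∀ B ∈ F, A ≠ B → Disjoint A B) ∨
    ∃ A ∈ F, ∃ A' ∈ F, A ≠ A' ∧ ∃ a ∈ A, a ∈ A' ∧ ∀ B ∈ F, B ≠ A → ∀ x ∈ A, x ∈ B → x = a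

theorem IsCliqueForest.isClique {F : Finset (Finset V)} (h : IsCliqueForest G q k F)
    (hA : A ∈ F) : G.IsClique (A : Set V) := fun x hx y hy hxy =>
  (h.adj x y).2 ⟨hxy, A, hA, hx, hy⟩

variable [Fintype V]

/-- Gluing a clique `A` along its vertex `a` to a forest of cliques gives a forest of cliques. -/
theorem IsCliqueForest.insert {F : Finset (Finset V)}
    (h : IsCliqueForest (isolate G (A.erase a)) q k F) (hq : 0 < q) (hA : G.IsNClique (q + 1) A)
    (hN : ∀ x ∈ A.erase a, closedNbhd G x = A) : IsCliqueForest G q (k + 1) (insert A F) := by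
  have hdis : ∀ B ∈ F, ∀ x ∈ A, x ∈ B → x = a := by
    intro B hB x hxA hxB
    by_contra hne
    exact Finset.disjoint_left.1 (disjoint_of_isolate (h.isClique hB) (by rw [h.size B hB]; omega))
      hxB (mem_erase.2 ⟨hne, hxA⟩)
  have hAF : A ∉ F := by
    intro hAF
    have : A ⊆ {a} := fun x hx => Finset.mem_singleton.2 (hdis A hAF x hx hx)
    have := card_le_card this
    rw [hA.card_eq, card_singleton] at this
    omega
  refine ⟨by rw [card_insert_of_notMem hAF, h.card], ?_, ?_, ?_, ?_⟩
  · intro B hB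
    rcases mem_insert.1 hB with rfl | hB
    · exact hA.card_eq
    · exact h.size B hB
  · intro x y
    constructor
    · intro hxy
      refine ⟨hxy.ne, ?_⟩
      by_cases hx : x ∈ A.erase a
      · refine ⟨A, mem_insert_self _ _, mem_of_mem_erase hx, ?_⟩
        rw [← hN x hx]
        exact mem_closedNbhd.2 (Or.inr hxy)
      by_cases hy : y ∈ A.erase a
      · refine ⟨A, mem_insert_self _ _, ?_, mem_of_mem_erase hy⟩
        rw [← hN y hy]
        exact mem_closedNbhd.2 (Or.inr hxy.symm)
      · obtain ⟨-, B, hB, hB'⟩ := (h.adj x y).1 ⟨hxy, hx, hy⟩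
        exact ⟨B, mem_insert_of_mem hB, hB'⟩
    · rintro ⟨hne, B, hB, hx, hy⟩
      rcases mem_insert.1 hB with rfl | hB
      · exact hA.isClique hx hy hne
      · exact ((h.adj x y).2 ⟨hne, B, hB, hx, hy⟩).1
  · intro s hs h2
    by_cases hd : Disjoint s (A.erase a)
    · obtain ⟨B, hB, hsB⟩ := h.exists_subset s (isClique_isolate hs hd) h2
      exact ⟨B, mem_insert_of_mem hB, hsB⟩
    · obtain ⟨x, hxs, hxA⟩ := Finset.not_disjoint_iff.1 hd
      exact ⟨A, mem_insert_self _ _, hN x hxA ▸ subset_closedNbhd hs hxs⟩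
  · have new : ∀ B ∈ F, a ∈ A → a ∈ B → ∃ A₁ ∈ Insert.insert A F, ∃ A' ∈ Insert.insert A F,
        A₁ ≠ A' ∧ ∃ a ∈ A₁, a ∈ A' ∧
        ∀ B ∈ Insert.insert A F, B ≠ A₁ → ∀ x ∈ A₁, x ∈ B → x = a := by
      intro B hB haA haB
      refine ⟨A, mem_insert_self _ _, B, mem_insert_of_mem hB, fun e => hAF (e ▸ hB), a, haA, haB,
        fun C hC hCA x hx hxC => ?_⟩
      exact hdis C ((mem_insert.1 hC).resolve_left hCA) x hx hxC
    rcases h.leaf with hl | ⟨A₁, hA₁, A', hA', hne, b, hb, hb', hl⟩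
    · by_cases hex : ∃ B ∈ F, a ∈ A ∧ a ∈ B
      · obtain ⟨B, hB, haA, haB⟩ := hex
        exact Or.inr (new B hB haA haB)
      · left
        have key : ∀ B ∈ F, Disjoint A B := by
          intro B hB
          rw [Finset.disjoint_left]
          intro x hx hxB
          have := hdis B hB x hx hxB
          subst this
          exact hex ⟨B, hB, hx, hxB⟩
        intro B hB C hC hBC
        rcases mem_insert.1 hB with hBA | hBF <;> rcases mem_insert.1 hC with hCA | hCF
        · exact absurd (hBA.trans hCA.symm) hBC
        · exact hBA ▸ key C hCF
        · exact hCA ▸ (key B hBF).symm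
        · exact hl B hBF C hCF hBC
    · right
      by_cases hcase : a ∈ A ∧ a ∈ A₁ ∧ a ≠ b
      · exact new A₁ hA₁ hcase.1 hcase.2.1
      · refine ⟨A₁, mem_insert_of_mem hA₁, A', mem_insert_of_mem hA', hne, b, hb, hb', ?_⟩
        intro B hB hBA₁ x hx hxB
        rcases mem_insert.1 hB with rfl | hB
        · have := hdis A₁ hA₁ x hxB hx
          subst this
          by_contra hxb
          exact hcase ⟨hxB, hx, hxb⟩
        · exact hl B hB hBA₁ x hx hxB

/-! ### Degree sums of critical graphs -/

theorem degree_isolate_add_le (hA : G.IsNClique (q + 1) A) (x : V) :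
    (isolate G (A.erase a)).degree x + (if x ∈ A then q else 0) ≤ G.degree x := by
  have hsub : (isolate G (A.erase a)).neighborFinset x ⊆ G.neighborFinset x := by
    intro y hy
    rw [mem_neighborFinset] at hy ⊢
    exact hy.1
  split_ifs with hx
  · have hsub' : A.erase x ⊆ G.neighborFinset x := by
      intro y hy
      rw [mem_neighborFinset]
      exact hA.isClique hx (mem_of_mem_erase hy) (ne_of_mem_erase hy).symm
    have hd : Disjoint ((isolate G (A.erase a)).neighborFinset x) (A.erase x) := by
      rw [Finset.disjoint_left]
      intro y hy hyA
      rw [mem_neighborFinset, isolate_adj] at hy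
      have hxa : x = a := by
        by_contra hxa
        exact hy.2.1 (mem_erase.2 ⟨hxa, hx⟩)
      exact hy.2.2 (hxa ▸ hyA)
    have := card_le_card (union_subset hsub hsub')
    rw [card_union_of_disjoint hd, card_erase_of_mem hx, hA.card_eq,
      card_neighborFinset_eq_degree, card_neighborFinset_eq_degree] at this
    exact this
  · have := card_le_card hsub
    rwa [card_neighborFinset_eq_degree, card_neighborFinset_eq_degree] at this

/-- The degree sum of a critical graph is at least that of `k` disjoint copies of `K_{q+1}`, with
equality only for forests of cliques. -/
theorem IsCritical.sum_degree [Nonempty V] (h : IsCritical G q k)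
    (hq : 3 ≤ q ∨ q = 2 ∧ ∀ x y z, G.Adj x y → G.Adj y z → x ≠ z → G.Adj x z) :
    k * (q * (q + 1)) ≤ ∑ u, G.degree u ∧
      (∑ u, G.degree u = k * (q * (q + 1)) → ∃ F, IsCliqueForest G q k F) := by
  have hq2 : 2 ≤ q := by omega
  induction k generalizing G with
  | zero =>
    refine ⟨by simp, fun _ => ⟨∅, rfl, by simp, fun x y => ?_, fun s hs h2 => ?_, by simp⟩⟩
    · simpa using fun hxy => by simpa using h.cover ∅ ⟨by simp, by simp, rfl⟩ x y hxy
    · obtain ⟨x, hx, y, hy, hxy⟩ := one_lt_card.1 h2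
      simpa using h.cover ∅ ⟨by simp, by simp, rfl⟩ x y (hs hx hy hxy)
  | succ m ih =>
    obtain ⟨u₀, w₀, huw⟩ : ∃ u w, G.Adj u w := by
      obtain ⟨v⟩ := ‹Nonempty V›
      obtain ⟨P, hP, -⟩ := h.avoid v
      obtain ⟨s, hs⟩ := card_pos.1 (by rw [hP.card]; omega : 0 < P.card)
      obtain ⟨x, hx, y, hy, hxy⟩ :=
        one_lt_card.1 (by rw [(hP.clique s hs).card_eq]; omega : 1 < s.card)
      exact ⟨x, y, (hP.clique s hs).isClique hx hy hxy⟩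
    by_cases hred : ∃ A, ∃ a ∈ A, G.IsNClique (q + 1) A ∧ ∀ P, IsPacking G q (m + 1) P →
        ∀ s ∈ P, ∀ t ∈ P, s ≠ t → Disjoint s (A.erase a) ∨ Disjoint t (A.erase a)
    · obtain ⟨A, a, ha, hA, h1⟩ := hred
      have h' := h.isolate hq2 (by omega) hA ha h1
      rw [Nat.add_sub_cancel] at h'
      have hih := ih h' (hq.imp_right fun ⟨hq, htr⟩ => ⟨hq, fun x y z hxy hyz hxz =>
        ⟨htr x y z hxy.1 hyz.1 hxz, hxy.2.1, hyz.2.2⟩⟩)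
      have hle := sum_le_sum fun x (_ : x ∈ (univ : Finset V)) =>
        degree_isolate_add_le (a := a) hA x
      have hsum : ∑ x, (if x ∈ A then q else 0) = (q + 1) * q := by
        rw [← sum_filter, filter_univ_mem, sum_const, hA.card_eq, smul_eq_mul]
      have heq' := sum_eq_sum_iff_of_le fun x (_ : x ∈ (univ : Finset V)) =>
        degree_isolate_add_le (a := a) hA x
      rw [sum_add_distrib, hsum] at hle heq'
      refine ⟨by nlinarith [hih.1], fun heq => ?_⟩
      have hS : ∑ u, (CliqueSat.isolate G (A.erase a)).degree u = m * (q * (q + 1)) := by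
        nlinarith [hih.1]
      have hpt := heq'.1 (by rw [hS, heq]; ring)
      obtain ⟨F, hF⟩ := hih.2 hS
      refine ⟨insert A F, hF.insert (by omega) hA fun x hx => ?_⟩
      have hxA := mem_of_mem_erase hx
      have h0 : (CliqueSat.isolate G (A.erase a)).degree x = 0 := by
        rw [degree_eq_zero]
        exact fun y hy => hy.2.1 hx
      have hd := hpt x (mem_univ x)
      rw [h0, if_pos hxA, zero_add] at hd
      refine (eq_of_subset_of_card_le (subset_closedNbhd hA.isClique hxA) ?_).symm
      rw [card_closedNbhd, ← hd, hA.card_eq]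
    · have hbig : (q + 1) * (univ.filter fun u => 0 < G.degree u).card ≤ ∑ u, G.degree u := by
        rcases hq with hq | ⟨rfl, htr⟩
        · refine h.mul_card_le_sum_degree hq fun A hA => ?_
          by_contra hlt
          refine hred ?_
          obtain ⟨a, ha, hsub⟩ : ∃ a ∈ A, payers G q A ⊆ {a} := by
            rcases (payers G q A).eq_empty_or_nonempty with he | ⟨a, ha⟩
            · obtain ⟨u, hu, -⟩ := hA.exists_low
              exact ⟨u, hu, by simp [he]⟩
            · refine ⟨a, (mem_payers.1 ha).1, fun b hb => Finset.mem_singleton.2 ?_⟩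
              exact card_le_one.1 (by omega) b hb a ha
          exact ⟨A, a, ha, hA.clique, fun P hP s hs t ht hst =>
            h.disjoint_or_disjoint hA (Or.inl hq) hsub hP hs ht hst⟩
        · refine h.mul_card_le_sum_degree_of_ne fun u hu => hred ?_
          -- By transitivity, a vertex of degree 2 lies in a component that is a triangle.
          have hcl : G.IsClique (closedNbhd G u : Set V) := by
            intro x hx y hy hxy
            rw [mem_coe, mem_closedNbhd] at hx hy
            rcases hx with rfl | hx <;> rcases hy with rfl | hy
            · exact absurd rfl hxy
            · exact hy
            · exact hx.symm
            · exact htr x u y hx.symm hy hxy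
          have hcard : (closedNbhd G u).card = 3 := by rw [card_closedNbhd, hu]
          refine ⟨closedNbhd G u, u, self_mem_closedNbhd, ⟨hcl, hcard⟩, ?_⟩
          intro P hP s hs t ht hst
          by_contra hc
          push Not at hc
          have hsub : ∀ r ∈ P, ¬ Disjoint r ((closedNbhd G u).erase u) → r ⊆ closedNbhd G u := by
            intro r hr hd x hx
            obtain ⟨y, hyr, hyA⟩ := Finset.not_disjoint_iff.1 hd
            have huy := (mem_closedNbhd.1 (mem_of_mem_erase hyA)).resolve_left
              (ne_of_mem_erase hyA)
            rw [mem_closedNbhd]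
            by_cases hxu : x = u
            · exact Or.inl hxu
            by_cases hxy : x = y
            · exact Or.inr (hxy ▸ huy)
            · exact Or.inr (htr u y x huy ((hP.clique r hr).isClique hyr hx (Ne.symm hxy))
                (Ne.symm hxu))
          have := card_le_card (union_subset (hsub s hs hc.1) (hsub t ht hc.2))
          rw [card_union_of_disjoint (hP.disj s hs t ht hst), (hP.clique s hs).card_eq,
            (hP.clique t ht).card_eq, hcard] at this
          omega
      have hlt := h.lt_card hq2 huw
      have : (m + 1) * (q * (q + 1)) < ∑ u, G.degree u := by nlinarith
      exact ⟨this.le, fun e => absurd e this.ne'⟩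

end Forest

section Saturated

open scoped Classical

variable {V : Type*} {G : SimpleGraph V} {p q k : ℕ} {S : Finset V} {u v : V}

/-! ### Copies of `K_p ∪ k K_q` as families of cliques -/

theorem isContained_cliqueUnion_iff (hq : 0 < q) : (cliqueUnion p k q).IsContained G ↔
    ∃ C P, G.IsNClique p C ∧ IsPacking G q k P ∧ ∀ s ∈ P, Disjoint C s := by
  constructor
  · rintro ⟨⟨f, hf⟩⟩
    have hfi : Function.Injective f := hf
    set Q : Fin k → Finset V := fun i => univ.image fun j => f (Sum.inr (i, j)) with hQ
    have hQc : ∀ i, (Q i).card = q := by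
      intro i
      rw [hQ, card_image_of_injective _ fun a b hab => by simpa using hfi hab]
      simp
    have hQd : ∀ i j, i ≠ j → Disjoint (Q i) (Q j) := by
      intro i j hij
      rw [Finset.disjoint_left]
      intro x hx hx'
      obtain ⟨a, -, rfl⟩ := mem_image.1 hx
      obtain ⟨b, -, hb⟩ := mem_image.1 hx'
      have := hfi hb
      simp only [Sum.inr.injEq, Prod.mk.injEq] at this
      exact hij this.1.symm
    have hQi : Function.Injective Q := by
      intro i j hij
      by_contra hne
      have := hQd i j hne
      rw [hij, disjoint_self] at this
      have h0 := hQc j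
      rw [show Q j = ∅ from this, card_empty] at h0
      omega
    refine ⟨univ.image fun j => f (Sum.inl j), univ.image Q, ⟨?_, ?_⟩, ⟨?_, ?_, ?_⟩, ?_⟩
    · intro x hx y hy hxy
      simp only [coe_image, coe_univ, Set.image_univ, Set.mem_range] at hx hy
      obtain ⟨i, rfl⟩ := hx
      obtain ⟨j, rfl⟩ := hy
      apply f.map_adj
      show i ≠ j
      rintro rfl
      exact hxy rfl
    · rw [card_image_of_injective _ fun a b hab => by simpa using hfi hab]
      simp
    · intro s hs
      obtain ⟨i, -, rfl⟩ := mem_image.1 hs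
      refine ⟨?_, hQc i⟩
      intro x hx y hy hxy
      simp only [hQ, coe_image, coe_univ, Set.image_univ, Set.mem_range] at hx hy
      obtain ⟨a, rfl⟩ := hx
      obtain ⟨b, rfl⟩ := hy
      apply f.map_adj
      refine ⟨rfl, ?_⟩
      show a ≠ b
      rintro rfl
      exact hxy rfl
    · intro s hs t ht hst
      obtain ⟨i, -, rfl⟩ := mem_image.1 hs
      obtain ⟨j, -, rfl⟩ := mem_image.1 ht
      exact hQd i j fun e => hst (e ▸ rfl)
    · rw [card_image_of_injective _ hQi]
      simp
    · intro s hs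
      obtain ⟨i, -, rfl⟩ := mem_image.1 hs
      rw [Finset.disjoint_left]
      intro x hx hx'
      obtain ⟨a, -, rfl⟩ := mem_image.1 hx
      obtain ⟨b, -, hb⟩ := mem_image.1 hx'
      have := hfi hb
      simp at this
  · rintro ⟨C, P, hC, hP, hd⟩
    set c : Fin p ≃ C := (equivFinOfCardEq hC.card_eq).symm
    set e : Fin k ≃ P := (equivFinOfCardEq hP.card).symm
    have h1 : ∀ s : P, s.1.card = q := fun s => (hP.clique s.1 s.2).card_eq
    set g : ∀ s : P, Fin q ≃ s.1 := fun s => (equivFinOfCardEq (h1 s)).symm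
    set f : Fin p ⊕ Fin k × Fin q → V :=
      Sum.elim (fun i => (c i).1) fun x => (g (e x.1) x.2).1 with hf
    have hcm : ∀ i, (c i).1 ∈ C := fun i => (c i).2
    have hgm : ∀ i j, (g (e i) j).1 ∈ (e i).1 := fun i j => (g (e i) j).2
    refine ⟨⟨⟨f, ?_⟩, ?_⟩⟩
    · rintro (i | ⟨i, j⟩) (i' | ⟨i', j'⟩) h
      · refine hC.isClique (hcm i) (hcm i') fun he => ?_
        exact (show i ≠ i' from h) (c.injective (Subtype.ext he))
      · exact absurd h (by simp [cliqueUnion])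
      · exact absurd h (by simp [cliqueUnion])
      · obtain ⟨hi, hj⟩ : i = i' ∧ j ≠ j' := h
        subst hi
        refine (hP.clique _ (e i).2).isClique (hgm i j) (hgm i j') fun he => ?_
        exact hj ((g (e i)).injective (Subtype.ext he))
    · rintro (i | ⟨i, j⟩) (i' | ⟨i', j'⟩) h
      · have h : (c i).1 = (c i').1 := h
        rw [c.injective (Subtype.ext h)]
      · have h : (c i).1 = (g (e i') j').1 := h
        exact absurd (h ▸ hgm i' j') (Finset.disjoint_left.1 (hd _ (e i').2) (hcm i))
      · have h : (g (e i) j).1 = (c i').1 := h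
        exact absurd (h ▸ hgm i j) (Finset.disjoint_left.1 (hd _ (e i).2) (hcm i'))
      · have h : (g (e i) j).1 = (g (e i') j').1 := h
        have hi : i = i' := e.injective (Subtype.ext
          (hP.eq_of_mem (e i).2 (e i').2 (hgm i j) (h ▸ hgm i' j')))
        subst hi
        rw [(g (e i)).injective (Subtype.ext h)]

/-- A clique of `G + uv` that is not a clique of `G` contains `u` and `v`. -/
theorem isClique_of_sup_edge {s : Finset V} (hs : (G ⊔ edge u v).IsClique (s : Set V))
    (h : ¬ (u ∈ s ∧ v ∈ s)) : G.IsClique (s : Set V) := by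
  intro x hx y hy hxy
  rcases hs hx hy hxy with h1 | h1
  · exact h1
  · rw [edge_adj] at h1
    rcases h1.1 with ⟨rfl, rfl⟩ | ⟨rfl, rfl⟩
    · exact absurd ⟨hx, hy⟩ h
    · exact absurd ⟨hy, hx⟩ h

/-- The copy of `K_p ∪ k K_q` in `G + uv`, as a clique `M` that contains the new edge and a family
`F` of `k` cliques of `G`. If `p < q`, either `M` or one member of `F` is the copy of `K_p`. -/
theorem IsSaturated.exists_cliques (h : IsSaturated (cliqueUnion p k q) G) (hp : 0 < p)
    (hpq : p ≤ q) (huv : u ≠ v) (hn : ¬ G.Adj u v) :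
    ∃ (M : Finset V) (F : Finset (Finset V)), u ∈ M ∧ v ∈ M ∧
      (G ⊔ edge u v).IsClique (M : Set V) ∧ p ≤ M.card ∧ M.card ≤ q ∧ F.card = k ∧
      (∀ s ∈ F, G.IsClique (s : Set V) ∧ s.card ≤ q ∧ Disjoint M s) ∧
      (∀ s ∈ F, ∀ t ∈ F, s ≠ t → Disjoint s t) ∧ M.card + ∑ s ∈ F, s.card = p + q * k := by
  obtain ⟨C, P, hC, hP, hd⟩ := (isContained_cliqueUnion_iff (by omega)).1
    (h.2 u v ((compl_adj ..).2 ⟨huv, hn⟩))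
  have hsum : ∑ s ∈ P, s.card = q * k := by
    rw [mul_comm, ← hP.card]
    exact sum_const_nat fun s hs => (hP.clique s hs).card_eq
  by_cases hCuv : u ∈ C ∧ v ∈ C
  · refine ⟨C, P, hCuv.1, hCuv.2, hC.isClique, hC.card_eq.ge, hC.card_eq.trans_le hpq, hP.card,
      fun s hs => ⟨?_, (hP.clique s hs).card_eq.le, hd s hs⟩, hP.disj, by rw [hC.card_eq, hsum]⟩
    exact isClique_of_sup_edge (hP.clique s hs).isClique fun hc =>
      Finset.disjoint_left.1 (hd s hs) hCuv.1 hc.1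
  · have hCG := isClique_of_sup_edge hC.isClique hCuv
    obtain ⟨M, hM, hMuv⟩ : ∃ s ∈ P, u ∈ s ∧ v ∈ s := by
      by_contra hno
      push Not at hno
      refine h.1 ((isContained_cliqueUnion_iff (by omega)).2 ⟨C, P, ⟨hCG, hC.card_eq⟩,
        ⟨fun s hs => ⟨?_, (hP.clique s hs).card_eq⟩, hP.disj, hP.card⟩, hd⟩)
      exact isClique_of_sup_edge (hP.clique s hs).isClique fun hc => hno s hs hc.1 hc.2
    have hMc := (hP.clique M hM).card_eq
    have hCP : C ∉ P.erase M := by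
      intro hCP
      have := hd C (mem_of_mem_erase hCP)
      rw [disjoint_self] at this
      have h0 := hC.card_eq
      rw [show C = ∅ from this, card_empty] at h0
      omega
    have hk := card_pos.2 ⟨M, hM⟩
    rw [hP.card] at hk
    refine ⟨M, insert C (P.erase M), hMuv.1, hMuv.2, (hP.clique M hM).isClique, by omega,
      by omega, ?_, ?_, ?_, ?_⟩
    · rw [card_insert_of_notMem hCP, card_erase_of_mem hM, hP.card]
      omega
    · intro s hs
      rcases mem_insert.1 hs with rfl | hs
      · exact ⟨hCG, hC.card_eq.trans_le hpq, (hd M hM).symm⟩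
      · have hsP := mem_of_mem_erase hs
        have hMs := hP.disj M hM s hsP (ne_of_mem_erase hs).symm
        exact ⟨isClique_of_sup_edge (hP.clique s hsP).isClique fun hc =>
          Finset.disjoint_left.1 hMs hMuv.1 hc.1, (hP.clique s hsP).card_eq.le, hMs⟩
    · intro s hs t ht hst
      rcases mem_insert.1 hs with hsC | hsP <;> rcases mem_insert.1 ht with htC | htP
      · exact absurd (hsC.trans htC.symm) hst
      · exact hsC ▸ hd t (mem_of_mem_erase htP)
      · exact htC ▸ (hd s (mem_of_mem_erase hsP)).symm
      · exact hP.disj s (mem_of_mem_erase hsP) t (mem_of_mem_erase htP) hst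
    · rw [sum_insert hCP, hC.card_eq]
      have := add_sum_erase P card hM
      omega

/-- Two non-adjacent vertices of a saturated graph have `p - 2` pairwise adjacent common
neighbours. -/
theorem IsSaturated.exists_common_clique (h : IsSaturated (cliqueUnion p k q) G) (hp : 0 < p)
    (hpq : p ≤ q) (huv : u ≠ v) (hn : ¬ G.Adj u v) :
    ∃ T : Finset V, G.IsNClique (p - 2) T ∧ ∀ x ∈ T, G.Adj u x ∧ G.Adj v x := by
  obtain ⟨M, -, hu, hv, hM, hpM, -⟩ := h.exists_cliques hp hpq huv hn
  have hc : p - 2 ≤ ((M.erase u).erase v).card := by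
    rw [card_erase_of_mem (mem_erase.2 ⟨huv.symm, hv⟩), card_erase_of_mem hu]
    omega
  obtain ⟨T, hT, hTc⟩ := exists_subset_card_eq hc
  have hmem : ∀ x ∈ T, x ≠ v ∧ x ≠ u ∧ x ∈ M := fun x hx => by simpa using hT hx
  refine ⟨T, ⟨isClique_of_sup_edge (hM.subset fun x hx => (hmem x hx).2.2)
    fun hc => (hmem u hc.1).2.1 rfl, hTc⟩, fun x hx => ?_⟩
  obtain ⟨hxv, hxu, hxM⟩ := hmem x hx
  constructor
  · refine (hM hu hxM hxu.symm).resolve_right fun he => ?_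
    rw [edge_adj] at he
    tauto
  · refine (hM hv hxM hxv.symm).resolve_right fun he => ?_
    rw [edge_adj] at he
    tauto

/-! ### Transitivity of adjacency in the case of matchings -/

/-- Gallai's argument: if each vertex and each pair of non-adjacent vertices is missed by a maximum
matching, then adjacency is transitive. Otherwise there are `x ~ y ~ z` with `x`, `z` not
adjacent, and matchings `M₁` missing `x` and `z` and `M₂` missing `y`; the number of edges
common to both could be increased indefinitely. -/
theorem IsCritical.trans (h : IsCritical G 2 k)
    (hN : ∀ x z, x ≠ z → ¬ G.Adj x z → ∃ P, IsPacking G 2 k P ∧ ∀ s ∈ P, x ∉ s ∧ z ∉ s)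
    (x y z : V) (hxy : G.Adj x y) (hyz : G.Adj y z) (hxz : x ≠ z) : G.Adj x z := by
  by_contra hn
  have key : ∀ m, ∃ M₁ M₂, IsPacking G 2 k M₁ ∧ IsPacking G 2 k M₂ ∧
      (∀ s ∈ M₁, x ∉ s ∧ z ∉ s) ∧ (∀ s ∈ M₂, y ∉ s) ∧ m ≤ (M₁ ∩ M₂).card := by
    intro m
    induction m with
    | zero =>
      obtain ⟨M₁, h₁, hx₁⟩ := hN x z hxz hn
      obtain ⟨M₂, h₂, hy₂⟩ := h.avoid y
      exact ⟨M₁, M₂, h₁, h₂, hx₁, hy₂, Nat.zero_le _⟩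
    | succ m ih =>
      obtain ⟨M₁, M₂, h₁, h₂, hx₁, hy₂, hm⟩ := ih
      have hcard : ∀ {P}, IsPacking G 2 k P → (P.biUnion id).card = k * 2 := by
        intro P hP
        rw [card_biUnion (t := id) fun s hs t ht hst => hP.disj s hs t ht hst, ← hP.card]
        exact sum_const_nat fun s hs => (hP.clique s hs).card_eq
      have h2 : 1 < (M₂.biUnion id \ M₁.biUnion id).card := by
        obtain ⟨s, hs, hxs⟩ := h.exists_mem h₂ hxy hy₂
        obtain ⟨t, ht, hzt⟩ := h.exists_mem h₂ hyz.symm hy₂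
        refine one_lt_card.2 ⟨x, mem_sdiff.2 ⟨mem_biUnion.2 ⟨s, hs, hxs⟩, ?_⟩, z,
          mem_sdiff.2 ⟨mem_biUnion.2 ⟨t, ht, hzt⟩, ?_⟩, hxz⟩
        · simpa using fun r hr => (hx₁ r hr).1
        · simpa using fun r hr => (hx₁ r hr).2
      rw [card_sdiff_comm ((hcard h₂).trans (hcard h₁).symm)] at h2
      obtain ⟨w, hw, hwy⟩ := exists_mem_ne h2 y
      rw [mem_sdiff, mem_biUnion, mem_biUnion] at hw
      obtain ⟨⟨e, he, hwe⟩, hw₂⟩ := hw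
      have hw₂ : ∀ s ∈ M₂, w ∉ s := fun s hs hws => hw₂ ⟨s, hs, hws⟩
      have hwe : w ∈ e := hwe
      obtain ⟨v, hve, hvw⟩ := exists_mem_ne (by rw [(h₁.clique e he).card_eq]; norm_num :
        1 < e.card) w
      have hev : ∀ a ∈ e, a = w ∨ a = v := by
        have : {w, v} = e := eq_of_subset_of_card_le (by
          intro a ha
          rcases mem_insert.1 ha with rfl | ha
          · exact hwe
          · exact Finset.mem_singleton.1 ha ▸ hve)
          (by rw [(h₁.clique e he).card_eq, card_pair hvw.symm])
        intro a ha
        simpa [← this] using ha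
      obtain ⟨f, hf, hvf⟩ := h.exists_mem h₂ ((h₁.clique e he).isClique hve hwe hvw) hw₂
      have he₂ : e ∉ M₂ := fun he₂ => hw₂ e he₂ hwe
      have hf₁ : f ∉ M₁ := fun hf₁ => he₂ (h₁.eq_of_mem hf₁ he hvf hve ▸ hf)
      refine ⟨M₁, insert e (M₂.erase f), h₁, h₂.replace (by norm_num) hf (h₁.clique e he) ?_,
        hx₁, ?_, ?_⟩
      · intro t ht htf
        rw [Finset.disjoint_left]
        intro a hae hat
        rcases hev a hae with rfl | rfl
        · exact hw₂ t ht hat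
        · exact htf (h₂.eq_of_mem ht hf hat hvf)
      · intro s hs hys
        rcases mem_insert.1 hs with rfl | hs
        · rcases hev y hys with rfl | rfl
          · exact hwy rfl
          · exact hy₂ f hf hvf
        · exact hy₂ s (mem_of_mem_erase hs) hys
      · have hsub : insert e (M₁ ∩ M₂) ⊆ M₁ ∩ insert e (M₂.erase f) := by
          intro s hs
          rcases mem_insert.1 hs with rfl | hs
          · exact mem_inter.2 ⟨he, mem_insert_self _ _⟩
          · rw [mem_inter] at hs
            exact mem_inter.2 ⟨hs.1, mem_insert_of_mem (mem_erase.2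
              ⟨fun e => hf₁ (e ▸ hs.1), hs.2⟩)⟩
        have := card_le_card hsub
        rw [card_insert_of_notMem fun he' => he₂ (mem_inter.1 he').2] at this
        omega
  obtain ⟨M₁, M₂, h₁, -, -, -, hm⟩ := key (k + 1)
  have := card_le_card (inter_subset_left (s₁ := M₁) (s₂ := M₂))
  rw [h₁.card] at this
  omega

end Saturated

section Extremal

open scoped Classical

variable {V : Type*} {G : SimpleGraph V} {p q k : ℕ} {S : Finset V} {F : Finset (Finset V)}
  {v : V}

/-! ### The extremal graphs -/

/-- `G` is the join of a clique on the `p - 2` vertices of `S` with the disjoint union of the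
`k` cliques in `F`, of `q + 1` vertices each, and isolated vertices. -/
structure IsExtremal (G : SimpleGraph V) (p q k : ℕ) (S : Finset V) (F : Finset (Finset V)) :
    Prop where
  card_core : S.card = p - 2
  card : F.card = k
  size : ∀ A ∈ F, A.card = q + 1
  disj : ∀ A ∈ F, ∀ B ∈ F, A ≠ B → Disjoint A B
  disj_core : ∀ A ∈ F, Disjoint A S
  adj : ∀ x y, G.Adj x y ↔ x ≠ y ∧ (x ∈ S ∨ y ∈ S ∨ ∃ A ∈ F, x ∈ A ∧ y ∈ A)

namespace IsExtremal

/-- Outside the core, a clique with two vertices lies in a member of `F`. -/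
theorem exists_sdiff_subset (h : IsExtremal G p q k S F) {s : Finset V}
    (hs : G.IsClique (s : Set V)) (h2 : 2 ≤ (s \ S).card) : ∃ A ∈ F, s \ S ⊆ A := by
  obtain ⟨x, hx, y, hy, hxy⟩ := one_lt_card.1 h2
  have key : ∀ z ∈ s \ S, z ≠ x → ∃ A ∈ F, x ∈ A ∧ z ∈ A := by
    intro z hz hzx
    rw [mem_sdiff] at hx hz
    exact (((h.adj x z).1 (hs hx.1 hz.1 hzx.symm)).2.resolve_left hx.2).resolve_left hz.2
  obtain ⟨A, hA, hxA, -⟩ := key y hy hxy.symm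
  refine ⟨A, hA, fun z hz => ?_⟩
  by_cases hzx : z = x
  · exact hzx ▸ hxA
  · obtain ⟨B, hB, hxB, hzB⟩ := key z hz hzx
    by_contra hzA
    exact Finset.disjoint_left.1 (h.disj A hA B hB fun e => hzA (e ▸ hzB)) hxA hxB

/-- An extremal graph has no copy of `K_p ∪ k K_q`: outside the core, each of the `k + 1` cliques
keeps at least two vertices, so two of them compete for one member of `F`. -/
theorem free (h : IsExtremal G p q k S F) (hp : 2 ≤ p) (hpq : p ≤ q) :
    (cliqueUnion p k q).Free G := by
  intro hc
  obtain ⟨C, P, hC, hP, hd⟩ := (isContained_cliqueUnion_iff (by omega)).1 hc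
  have hCP : C ∉ P := by
    intro hCP
    have := hd C hCP
    rw [disjoint_self] at this
    have h0 := hC.card_eq
    rw [show C = ∅ from this, card_empty] at h0
    omega
  have hdis : ∀ s ∈ insert C P, ∀ t ∈ insert C P, s ≠ t → Disjoint s t := by
    intro s hs t ht hst
    rcases mem_insert.1 hs with hsC | hsP <;> rcases mem_insert.1 ht with htC | htP
    · exact absurd (hsC.trans htC.symm) hst
    · exact hsC ▸ hd t htP
    · exact htC ▸ (hd s hsP).symm
    · exact hP.disj s hsP t htP hst
  have hcl : ∀ s ∈ insert C P, G.IsClique (s : Set V) ∧ p ≤ s.card := by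
    intro s hs
    rcases mem_insert.1 hs with rfl | hs
    · exact ⟨hC.isClique, hC.card_eq.ge⟩
    · exact ⟨(hP.clique s hs).isClique, by rw [(hP.clique s hs).card_eq]; exact hpq⟩
  have hex : ∀ s, ∃ A, s ∈ insert C P → A ∈ F ∧ s \ S ⊆ A := by
    intro s
    by_cases hs : s ∈ insert C P
    · obtain ⟨A, hA, hsA⟩ := h.exists_sdiff_subset (hcl s hs).1 (by
        have := le_card_sdiff S s
        have := (hcl s hs).2
        have := h.card_core
        omega)
      exact ⟨A, fun _ => ⟨hA, hsA⟩⟩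
    · exact ⟨∅, fun h => absurd h hs⟩
  choose β hβ using hex
  obtain ⟨s, hs, t, ht, hst, hβst⟩ := exists_ne_map_eq_of_card_lt_of_maps_to
    (by rw [card_insert_of_notMem hCP, hP.card, h.card]; omega : F.card < (insert C P).card)
    fun s hs => (hβ s hs).1
  have h1 := card_le_card (union_subset (hβ s hs).2 (hβst ▸ (hβ t ht).2))
  have hst' := hdis s hs t ht hst
  rw [card_union_of_disjoint (disjoint_of_subset_left sdiff_subset
    (disjoint_of_subset_right sdiff_subset hst')), h.size _ (hβ s hs).1] at h1
  have h2 : (s ∩ S).card + (t ∩ S).card ≤ p - 2 := by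
    rw [← h.card_core, ← card_union_of_disjoint (disjoint_of_subset_left inter_subset_left
      (disjoint_of_subset_right inter_subset_left hst'))]
    exact card_le_card (union_subset inter_subset_right inter_subset_right)
  have h3 := card_sdiff_add_card_inter s S
  have h4 := card_sdiff_add_card_inter t S
  have h5 : p + q ≤ s.card + t.card := by
    rcases mem_insert.1 hs with hsC | hsP
    · rcases mem_insert.1 ht with htC | htP
      · exact absurd (hsC.trans htC.symm) hst
      · rw [hsC, hC.card_eq, (hP.clique t htP).card_eq]
    · have := (hP.clique s hsP).card_eq
      have := (hcl t ht).2
      omega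
  omega

theorem isSaturated (h : IsExtremal G p q k S F) (hp : 2 ≤ p) (hpq : p ≤ q) :
    IsSaturated (cliqueUnion p k q) G := by
  refine ⟨h.free hp hpq, fun u v huv => ?_⟩
  obtain ⟨hne, hn⟩ := (compl_adj ..).1 huv
  have hn' : ¬ (u ∈ S ∨ v ∈ S ∨ ∃ A ∈ F, u ∈ A ∧ v ∈ A) := fun hc =>
    hn ((h.adj u v).2 ⟨hne, hc⟩)
  push Not at hn'
  obtain ⟨huS, hvS, hF⟩ := hn'
  have hex : ∀ A, ∃ B, A ∈ F → B ⊆ A ∧ B.card = q ∧ u ∉ B ∧ v ∉ B := by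
    intro A
    by_cases hA : A ∈ F
    · have hi : (A ∩ {u, v}).card ≤ 1 := by
        rw [card_le_one]
        intro x hx y hy
        simp only [mem_inter, mem_insert, Finset.mem_singleton] at hx hy
        have := hF A hA
        rcases hx with ⟨hxA, rfl | rfl⟩ <;> rcases hy with ⟨hyA, rfl | rfl⟩ <;> tauto
      have hle : q ≤ (A \ {u, v}).card := by
        have := card_sdiff_add_card_inter A {u, v}
        have := h.size A hA
        omega
      obtain ⟨B, hB, hBc⟩ := exists_subset_card_eq hle
      refine ⟨B, fun _ => ⟨hB.trans sdiff_subset, hBc, fun hu => ?_, fun hv => ?_⟩⟩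
      · simpa using hB hu
      · simpa using hB hv
    · exact ⟨∅, fun h => absurd h hA⟩
  choose β hβ using hex
  have hdis : ∀ A ∈ F, ∀ B ∈ F, A ≠ B → Disjoint (β A) (β B) := fun A hA B hB hAB =>
    disjoint_of_subset_left (hβ A hA).1 (disjoint_of_subset_right (hβ B hB).1
      (h.disj A hA B hB hAB))
  refine (isContained_cliqueUnion_iff (by omega)).2 ⟨insert u (insert v S), F.image β,
    ⟨?_, ?_⟩, ⟨?_, ?_, ?_⟩, ?_⟩
  · intro x hx y hy hxy
    simp only [coe_insert, Set.mem_insert_iff, mem_coe] at hx hy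
    by_cases hxS : x ∈ S ∨ y ∈ S
    · exact Or.inl ((h.adj x y).2 ⟨hxy, by tauto⟩)
    · right
      rw [edge_adj]
      push Not at hxS
      have hx := or_assoc.2 hx |>.resolve_right hxS.1
      have hy := or_assoc.2 hy |>.resolve_right hxS.2
      rcases hx with rfl | rfl <;> rcases hy with rfl | rfl <;> tauto
  · rw [card_insert_of_notMem, card_insert_of_notMem hvS, h.card_core]
    · omega
    · simp [hne, huS]
  · intro s hs
    obtain ⟨A, hA, rfl⟩ := mem_image.1 hs
    exact ⟨fun x hx y hy hxy => Or.inl ((h.adj x y).2 ⟨hxy, Or.inr (Or.inr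
      ⟨A, hA, (hβ A hA).1 hx, (hβ A hA).1 hy⟩)⟩), (hβ A hA).2.1⟩
  · intro s hs t ht hst
    obtain ⟨A, hA, rfl⟩ := mem_image.1 hs
    obtain ⟨B, hB, rfl⟩ := mem_image.1 ht
    exact hdis A hA B hB fun e => hst (e ▸ rfl)
  · rw [card_image_of_injOn, h.card]
    intro A hA B hB hAB
    by_contra hne
    have := hdis A hA B hB hne
    rw [hAB, disjoint_self] at this
    have h0 := (hβ B hB).2.1
    rw [show β B = ∅ from this, card_empty] at h0
    omega
  · intro s hs
    obtain ⟨A, hA, rfl⟩ := mem_image.1 hs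
    obtain ⟨hsub, -, hu, hv⟩ := hβ A hA
    rw [disjoint_insert_left, disjoint_insert_left]
    exact ⟨hu, hv, disjoint_of_subset_right hsub (h.disj_core A hA).symm⟩

end IsExtremal

/-! ### Degree sums -/

variable [Fintype V]

/-- The degree sum of a graph in which the vertices of `S` are adjacent to all others. -/
theorem sum_degree_eq_add_sum_isolate (hS : ∀ x ∈ S, ∀ y, x ≠ y → G.Adj x y) :
    ∑ x, G.degree x = S.card * (Fintype.card V - 1) +
      (Fintype.card V - S.card) * S.card + ∑ x, (isolate G S).degree x := by
  have h1 : ∀ x ∈ S, G.degree x = Fintype.card V - 1 := by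
    intro x hx
    have : G.neighborFinset x = univ.erase x := by
      ext y
      simp only [mem_neighborFinset, mem_erase, mem_univ, and_true]
      exact ⟨fun h => h.ne', fun h => hS x hx y h.symm⟩
    rw [← card_neighborFinset_eq_degree, this, card_erase_of_mem (mem_univ x), card_univ]
  have h2 : ∀ x ∈ S, (isolate G S).degree x = 0 := by
    intro x hx
    rw [degree_eq_zero]
    exact fun y hy => hy.2.1 hx
  have h3 : ∀ x ∈ Sᶜ, G.degree x = S.card + (isolate G S).degree x := by
    intro x hx
    rw [mem_compl] at hx
    have hd : Disjoint S ((isolate G S).neighborFinset x) := by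
      rw [Finset.disjoint_left]
      intro y hyS hy
      rw [mem_neighborFinset] at hy
      exact hy.2.2 hyS
    rw [← card_neighborFinset_eq_degree, ← card_neighborFinset_eq_degree,
      ← card_union_of_disjoint hd]
    congr 1
    ext y
    simp only [mem_neighborFinset, mem_union, isolate_adj]
    constructor
    · intro h
      by_cases hy : y ∈ S
      · exact Or.inl hy
      · exact Or.inr ⟨h, hx, hy⟩
    · rintro (hy | hy)
      · exact (hS y hy x fun e => hx (e ▸ hy)).symm
      · exact hy.1
  rw [← sum_add_sum_compl S, ← sum_add_sum_compl S fun x => (isolate G S).degree x,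
    sum_congr rfl h1, sum_congr rfl h2, sum_congr rfl h3, sum_add_distrib, sum_const, sum_const,
    sum_const, card_compl]
  simp only [smul_eq_mul, mul_zero, zero_add]
  ring

/-- The degree sum of the extremal graphs on `n` vertices. -/
def extremalDegreeSum (p q k n : ℕ) : ℕ :=
  (p - 2) * (n - 1) + (n - (p - 2)) * (p - 2) + k * (q * (q + 1))

theorem IsExtremal.sum_degree (h : IsExtremal G p q k S F) :
    ∑ x, G.degree x = extremalDegreeSum p q k (Fintype.card V) := by
  rw [sum_degree_eq_add_sum_isolate fun x hx y hxy => (h.adj x y).2 ⟨hxy, Or.inl hx⟩, h.card_core,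
    extremalDegreeSum]
  congr 1
  have h1 : ∀ A ∈ F, ∀ x ∈ A, (isolate G S).degree x = q := by
    intro A hA x hx
    have hxS := Finset.disjoint_left.1 (h.disj_core A hA) hx
    have : (isolate G S).neighborFinset x = A.erase x := by
      ext y
      rw [mem_neighborFinset, isolate_adj, h.adj, mem_erase]
      constructor
      · rintro ⟨⟨hne, hxy⟩, -, hyS⟩
        obtain ⟨B, hB, hxB, hyB⟩ := (hxy.resolve_left hxS).resolve_left hyS
        refine ⟨hne.symm, ?_⟩
        by_contra hyA
        exact Finset.disjoint_left.1 (h.disj A hA B hB fun e => hyA (e ▸ hyB)) hx hxB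
      · rintro ⟨hne, hyA⟩
        exact ⟨⟨hne.symm, Or.inr (Or.inr ⟨A, hA, hx, hyA⟩)⟩, hxS,
          Finset.disjoint_left.1 (h.disj_core A hA) hyA⟩
    rw [← card_neighborFinset_eq_degree, this, card_erase_of_mem hx, h.size A hA]
    rfl
  have h2 : ∀ x ∈ (univ : Finset V), x ∉ F.biUnion id → (isolate G S).degree x = 0 := by
    intro x _ hx
    rw [degree_eq_zero]
    rintro y ⟨hxy, hxS, hyS⟩
    obtain ⟨B, hB, hxB, -⟩ := (((h.adj x y).1 hxy).2.resolve_left hxS).resolve_left hyS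
    exact hx (mem_biUnion.2 ⟨B, hB, hxB⟩)
  rw [← sum_subset (subset_univ _) h2,
    sum_biUnion (t := id) fun A hA B hB hAB => h.disj A hA B hB hAB, ← h.card]
  refine sum_const_nat fun A hA => ?_
  rw [id, sum_const_nat (h1 A hA), mul_comm, h.size A hA]

/-! ### Saturated graphs of large minimum degree -/

/-- A saturated graph of minimum degree larger than `p - 2` has more edges than the extremal
graphs. -/
theorem IsSaturated.lt_sum_degree (h : IsSaturated (cliqueUnion p k q) G) (hp : 2 ≤ p)
    (hpq : p ≤ q) (hk : 0 < k) (hn : q * (q + 1) * k + 3 * (p - 2) < Fintype.card V)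
    (hδ : ∀ u, p - 2 < G.degree u) :
    extremalDegreeSum p q k (Fintype.card V) < ∑ x, G.degree x := by
  obtain ⟨D, rfl⟩ : ∃ D, p = D + 2 := ⟨p - 2, by omega⟩
  rw [extremalDegreeSum]
  simp only [Nat.add_sub_cancel] at hn hδ ⊢
  set n := Fintype.card V with hnd
  have : Nonempty V := Fintype.card_pos_iff.1 (by omega)
  obtain ⟨v, hv⟩ := G.exists_minimal_degree_vertex
  have hmin : ∀ u, G.degree v ≤ G.degree u := fun u => hv ▸ G.minDegree_le_degree u
  set d := G.degree v with hd
  have hDd := hδ v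
  rw [← hd] at hDd
  set Y := q * (q + 1) * k with hY
  have hYk : k * (q * (q + 1)) = Y := by rw [hY]; ring
  rw [hYk]
  obtain ⟨m, hm⟩ : ∃ m, n = Y + 3 * D + 1 + m := ⟨n - (Y + 3 * D + 1), by omega⟩
  have e1 : n - 1 = Y + 3 * D + m := by omega
  have e2 : n - D = Y + 2 * D + 1 + m := by omega
  rw [e1, e2]
  rcases Nat.lt_or_ge (2 * D) d with hbig | hsmall
  · have : n * d ≤ ∑ x, G.degree x := by
      rw [hnd, ← card_univ, ← smul_eq_mul]
      exact card_nsmul_le_sum _ _ _ fun u _ => hmin u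
    have h2 : n * (2 * D + 1) ≤ n * d := Nat.mul_le_mul_left n hbig
    rw [hm] at h2 this
    nlinarith
  · set N := G.neighborFinset v with hN
    set W := (insert v N)ᶜ with hW
    have hvN : v ∉ N := by simp [hN]
    have hNc : N.card = d := by rw [hN, card_neighborFinset_eq_degree]
    have hWc : W.card + d + 1 = n := by
      have := card_compl_add_card (insert v N)
      rw [card_insert_of_notMem hvN, hNc] at this
      omega
    have hWm : ∀ w ∈ W, w ≠ v ∧ ¬ G.Adj v w := by
      intro w hw
      simpa [hW, hN, not_or] using hw
    have hT : ∀ w ∈ W, ∃ T : Finset V, G.IsNClique D T ∧ ∀ x ∈ T, G.Adj v x ∧ G.Adj w x :=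
      fun w hw => h.exists_common_clique (by omega) hpq (hWm w hw).1.symm (hWm w hw).2
    -- Every vertex of `W` has at least `D` neighbours in `N`.
    have hWN : ∀ w ∈ W, D ≤ (N.filter fun x => G.Adj w x).card := by
      intro w hw
      obtain ⟨T, hTc, hT⟩ := hT w hw
      rw [← hTc.card_eq]
      refine card_le_card fun x hx => mem_filter.2 ⟨?_, (hT x hx).2⟩
      rw [hN, mem_neighborFinset]
      exact (hT x hx).1
    have hWne : W.Nonempty := by
      rw [← card_pos]
      omega
    -- The edges inside `N`, counted twice.
    have hNN : D * (D - 1) ≤ ∑ x ∈ N, (N.filter fun y => G.Adj x y).card := by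
      obtain ⟨w, hw⟩ := hWne
      obtain ⟨T, hTc, hT⟩ := hT w hw
      have hTN : T ⊆ N := fun x hx => by
        rw [hN, mem_neighborFinset]
        exact (hT x hx).1
      refine le_trans ?_ (sum_le_sum_of_subset hTN)
      rw [← smul_eq_mul]
      conv_lhs => rw [← hTc.card_eq]
      refine card_nsmul_le_sum _ _ _ fun x hx => ?_
      rw [← card_erase_of_mem hx]
      refine card_le_card fun y hy => mem_filter.2 ⟨hTN (mem_of_mem_erase hy), ?_⟩
      exact hTc.isClique hx (mem_of_mem_erase hy) (ne_of_mem_erase hy).symm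
    have hNdeg : ∀ x ∈ N, 1 + (N.filter fun y => G.Adj x y).card +
        (W.filter fun y => G.Adj x y).card ≤ G.degree x := by
      intro x hx
      have hxv : G.Adj x v := by
        rw [hN, mem_neighborFinset] at hx
        exact hx.symm
      rw [← card_neighborFinset_eq_degree]
      have h1 : Disjoint (N.filter fun y => G.Adj x y) (W.filter fun y => G.Adj x y) := by
        refine disjoint_filter_filter ?_
        rw [hW]
        exact disjoint_compl_right.mono_left (subset_insert _ _)
      have h2 : v ∉ (N.filter fun y => G.Adj x y) ∪ (W.filter fun y => G.Adj x y) := by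
        rw [mem_union, mem_filter, mem_filter]
        rintro (h | h)
        · exact hvN h.1
        · exact (hWm v h.1).1 rfl
      have h3 : insert v ((N.filter fun y => G.Adj x y) ∪ (W.filter fun y => G.Adj x y)) ⊆
          G.neighborFinset x := by
        intro y hy
        rw [mem_neighborFinset]
        rw [mem_insert, mem_union, mem_filter, mem_filter] at hy
        rcases hy with rfl | hy | hy
        · exact hxv
        · exact hy.2
        · exact hy.2
      have := card_le_card h3
      rw [card_insert_of_notMem h2, card_union_of_disjoint h1] at this
      omega
    have hdc : W.card * D ≤ ∑ x ∈ N, (W.filter fun y => G.Adj x y).card := by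
      have : ∑ x ∈ N, (W.filter fun y => G.Adj x y).card =
          ∑ w ∈ W, (N.filter fun x => G.Adj w x).card := by
        simp only [card_filter]
        rw [sum_comm]
        simp only [G.adj_comm]
      rw [this, ← smul_eq_mul]
      exact card_nsmul_le_sum _ _ _ hWN
    have hWd : W.card * d ≤ ∑ w ∈ W, G.degree w := by
      rw [← smul_eq_mul]
      exact card_nsmul_le_sum _ _ _ fun w _ => hmin w
    have hNs := sum_le_sum hNdeg
    rw [sum_add_distrib, sum_add_distrib, sum_const, hNc, smul_eq_mul, mul_one] at hNs
    have htot : ∑ x, G.degree x = (d + ∑ x ∈ N, G.degree x) + ∑ w ∈ W, G.degree w := by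
      rw [← sum_add_sum_compl (insert v N), sum_insert hvN]
    have hlow : 2 * d + D * (D - 1) + W.card * (D + d) ≤ ∑ x, G.degree x := by
      rw [htot, Nat.mul_add]
      omega
    refine lt_of_lt_of_le ?_ hlow
    clear_value d
    obtain ⟨j, rfl⟩ : ∃ j, d = D + 1 + j := ⟨d - (D + 1), by omega⟩
    have hjY : j * j ≤ j * Y := by
      refine Nat.mul_le_mul_left j ?_
      have : q * 1 ≤ Y := by
        rw [hY, mul_assoc]
        exact Nat.mul_le_mul_left q (Nat.mul_pos (Nat.succ_pos q) hk)
      omega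
    obtain ⟨i, rfl⟩ : ∃ i, D = j + 1 + i := ⟨D - (j + 1), by omega⟩
    have e3 : W.card = Y + (j + 1 + i) + i + m := by omega
    have e4 : j + 1 + i - 1 = j + i := by omega
    rw [e3, e4]
    linarith [Nat.zero_le (j * m), Nat.zero_le m]

/-! ### Saturated graphs with a vertex of degree `p - 2` -/

/-- The neighbours of a vertex `v` of degree `p - 2` in a saturated graph are adjacent to all other
vertices. -/
theorem IsSaturated.adj_of_adj (h : IsSaturated (cliqueUnion p k q) G) (hp : 2 ≤ p)
    (hpq : p ≤ q) (hn : p - 1 < Fintype.card V) (hv : G.degree v = p - 2) {x y : V}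
    (hx : G.Adj v x) (hxy : x ≠ y) : G.Adj x y := by
  have key : ∀ u, u ≠ v → ¬ G.Adj v u → G.IsClique (G.neighborFinset v : Set V) ∧
      ∀ z, G.Adj v z → G.Adj u z := by
    intro u huv hu
    obtain ⟨T, hT, hTa⟩ := h.exists_common_clique (by omega) hpq huv.symm hu
    have hTv : T = G.neighborFinset v := by
      apply eq_of_subset_of_card_le
      · intro z hz
        rw [mem_neighborFinset]
        exact (hTa z hz).1
      · rw [card_neighborFinset_eq_degree, hv, hT.card_eq]
    refine ⟨hTv ▸ hT.isClique, fun z hz => (hTa z ?_).2⟩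
    rw [hTv, mem_neighborFinset]
    exact hz
  obtain ⟨u, -, hu⟩ : ∃ u ∈ (univ : Finset V), u ∉ closedNbhd G v := by
    apply exists_mem_notMem_of_card_lt_card
    rw [card_closedNbhd, hv, card_univ]
    omega
  rw [mem_closedNbhd, not_or] at hu
  by_cases hyv : y = v
  · exact hyv ▸ hx.symm
  by_cases hy : G.Adj v y
  · exact (key u hu.1 hu.2).1 (by simpa using hx) (by simpa using hy) hxy
  · exact ((key y hyv hy).2 x hx).symm

/-- Isolating the neighbours of a vertex of degree `p - 2` in a saturated graph gives a critical
graph. -/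
theorem IsSaturated.isCritical (h : IsSaturated (cliqueUnion p k q) G) (hp : 2 ≤ p)
    (hpq : p ≤ q) (hn : p - 1 < Fintype.card V) (hv : G.degree v = p - 2) :
    IsCritical (isolate G (G.neighborFinset v)) q k := by
  have hSc : (G.neighborFinset v).card = p - 2 := by rw [card_neighborFinset_eq_degree, hv]
  have hS : ∀ x ∈ G.neighborFinset v, ∀ y, x ≠ y → G.Adj x y := fun x hx y hxy =>
    h.adj_of_adj hp hpq hn hv ((mem_neighborFinset ..).1 hx) hxy
  have key : ∀ u, u ∉ closedNbhd G v → ∃ F, IsPacking (isolate G (G.neighborFinset v)) q k F ∧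
      ∀ s ∈ F, u ∉ s ∧ Disjoint (closedNbhd G v) s := by
    intro u hu
    rw [mem_closedNbhd, not_or] at hu
    obtain ⟨M, F, hvM, huM, hM, hpM, -, hFc, hF, hFd, hsum⟩ :=
      h.exists_cliques (by omega) hpq (Ne.symm hu.1) hu.2
    have hsub : M.erase u ⊆ closedNbhd G v := by
      intro x hx
      rw [mem_closedNbhd]
      by_cases hxv : x = v
      · exact Or.inl hxv
      · right
        refine (hM hvM (mem_of_mem_erase hx) (Ne.symm hxv)).resolve_right fun he => ?_
        rw [edge_adj] at he
        have := ne_of_mem_erase hx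
        tauto
    have hcl : (closedNbhd G v).card = p - 1 := by
      rw [card_closedNbhd, hv]
      omega
    have hle := card_le_card hsub
    rw [card_erase_of_mem huM, hcl] at hle
    have hMv : M.erase u = closedNbhd G v := eq_of_subset_of_card_le hsub (by
      rw [card_erase_of_mem huM, hcl]
      omega)
    have hMs : closedNbhd G v ⊆ M := hMv ▸ erase_subset _ _
    have hsz : ∀ s ∈ F, s.card = q := by
      have hs : ∑ s ∈ F, s.card = ∑ s ∈ F, q := by
        rw [sum_const, hFc, smul_eq_mul, mul_comm]
        omega
      exact (sum_eq_sum_iff_of_le fun s hs => (hF s hs).2.1).1 hs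
    refine ⟨F, ⟨fun s hs => ⟨isClique_isolate (hF s hs).1 ?_, hsz s hs⟩, hFd, hFc⟩,
      fun s hs => ⟨Finset.disjoint_left.1 (hF s hs).2.2 huM,
        disjoint_of_subset_left hMs (hF s hs).2.2⟩⟩
    exact (disjoint_of_subset_left ((subset_insert _ _).trans hMs) (hF s hs).2.2).symm
  constructor
  · intro u
    by_cases hu : u ∈ closedNbhd G v
    · obtain ⟨w, -, hw⟩ : ∃ u ∈ (univ : Finset V), u ∉ closedNbhd G v := by
        apply exists_mem_notMem_of_card_lt_card
        rw [card_closedNbhd, hv, card_univ]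
        omega
      obtain ⟨F, hF, hF'⟩ := key w hw
      exact ⟨F, hF, fun s hs => Finset.disjoint_left.1 (hF' s hs).2 hu⟩
    · obtain ⟨F, hF, hF'⟩ := key u hu
      exact ⟨F, hF, fun s hs => (hF' s hs).1⟩
  · intro P hP x y hxy
    by_contra hc
    push Not at hc
    refine h.1 ((isContained_cliqueUnion_iff (by omega)).2
      ⟨insert x (insert y (G.neighborFinset v)), P, ⟨?_, ?_⟩, ⟨fun s hs =>
        ⟨isClique_of_isolate (hP.clique s hs).isClique, (hP.clique s hs).card_eq⟩, hP.disj, hP.card⟩,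
        fun s hs => ?_⟩)
    · intro a ha b hb hab
      rw [mem_coe, mem_insert, mem_insert] at ha hb
      by_cases haS : a ∈ G.neighborFinset v
      · exact hS a haS b hab
      by_cases hbS : b ∈ G.neighborFinset v
      · exact (hS b hbS a hab.symm).symm
      have ha := or_assoc.2 ha |>.resolve_right haS
      have hb := or_assoc.2 hb |>.resolve_right hbS
      rcases ha with rfl | rfl <;> rcases hb with rfl | rfl
      · exact absurd rfl hab
      · exact hxy.1
      · exact hxy.1.symm
      · exact absurd rfl hab
    · rw [card_insert_of_notMem, card_insert_of_notMem hxy.2.2, hSc]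
      · omega
      · rw [mem_insert, not_or]
        exact ⟨hxy.1.ne, hxy.2.1⟩
    · rw [disjoint_insert_left, disjoint_insert_left]
      refine ⟨(hc s hs).1, (hc s hs).2, (disjoint_of_isolate (hP.clique s hs).isClique ?_).symm⟩
      rw [(hP.clique s hs).card_eq]
      omega

/-- If the graph of `IsSaturated.isCritical` is a forest of cliques, the cliques are pairwise disjoint:
otherwise there are a vertex `a` in two of them, `A` and `A'`, with `A` meeting the others only in
`a`, and joining `x ∈ A` to `y ∈ A'` creates no copy of `K_p ∪ k K_q`, as the `k` cliques other than
the one through `x` and `y` would have to keep at least `q * k - 1` vertices outside the core and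
`x`, `y`, `a`. -/
theorem IsSaturated.disjoint_of_isCliqueForest (h : IsSaturated (cliqueUnion p k q) G)
    (hp : 2 ≤ p) (hpq : p ≤ q) (hv : G.degree v = p - 2)
    (hq : 3 ≤ q ∨ q = 2 ∧ ∀ x y z, (isolate G (G.neighborFinset v)).Adj x y →
      (isolate G (G.neighborFinset v)).Adj y z → x ≠ z →
      (isolate G (G.neighborFinset v)).Adj x z)
    (hF : IsCliqueForest (isolate G (G.neighborFinset v)) q k F) :
    ∀ A ∈ F, ∀ B ∈ F, A ≠ B → Disjoint A B := by
  refine hF.leaf.resolve_right ?_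
  rintro ⟨A, hA, A', hA', hne, a, haA, haA', hleaf⟩
  set S := G.neighborFinset v with hSd
  have hSc : S.card = p - 2 := by rw [hSd, card_neighborFinset_eq_degree, hv]
  have hA1 := hF.size A hA
  have hA1' := hF.size A' hA'
  obtain ⟨x, hxA, hxa⟩ := exists_mem_ne (by omega : 1 < A.card) a
  obtain ⟨y, hyA', hya⟩ := exists_mem_ne (by omega : 1 < A'.card) a
  have hyA : y ∉ A := fun hyA => hya (hleaf A' hA' hne.symm y hyA hyA')
  have hxy : x ≠ y := fun e => hyA (e ▸ hxA)
  have hxa' := (hF.adj x a).2 ⟨hxa, A, hA, hxA, haA⟩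
  have hay' := (hF.adj a y).2 ⟨hya.symm, A', hA', haA', hyA'⟩
  have hn' : ¬ (isolate G S).Adj x y := by
    intro hadj
    obtain ⟨-, B, hB, hxB, hyB⟩ := (hF.adj x y).1 hadj
    by_cases hBA : B = A
    · exact hyA (hBA ▸ hyB)
    · exact hxa (hleaf B hB hBA x hxA hxB)
  rcases hq with hq | ⟨-, htr⟩
  swap
  · exact hn' (htr x a y hxa' hay' hxy)
  have hnG : ¬ G.Adj x y := fun hadj => hn' ⟨hadj, hxa'.2.1, hay'.2.2⟩
  obtain ⟨M, Q, hxM, hyM, hM, -, -, hQc, hQ, hQd, hsum⟩ :=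
    h.exists_cliques (by omega) hpq hxy hnG
  set Y := insert x (insert y (insert a S)) with hY
  have hYc : Y.card ≤ p + 1 := by
    have h1 := card_insert_le x (insert y (insert a S))
    have h2 := card_insert_le y (insert a S)
    have h3 := card_insert_le a S
    rw [hY]
    omega
  have hMY : M ⊆ Y := by
    intro w hw
    by_contra hwY
    simp only [hY, mem_insert, not_or] at hwY
    obtain ⟨hwx, hwy, hwa, hwS⟩ := hwY
    have h1 : (isolate G S).Adj w x := by
      refine ⟨(hM hw hxM hwx).resolve_right fun he => ?_, hwS, hxa'.2.1⟩
      rw [edge_adj] at he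
      tauto
    have h2 : (isolate G S).Adj w y := by
      refine ⟨(hM hw hyM hwy).resolve_right fun he => ?_, hwS, hay'.2.2⟩
      rw [edge_adj] at he
      tauto
    obtain ⟨-, B, hB, hwB, hxB⟩ := (hF.adj w x).1 h1
    obtain ⟨-, C, hC, hwC, hyC⟩ := (hF.adj w y).1 h2
    have hBA : B = A := by
      by_contra hBA
      exact hxa (hleaf B hB hBA x hxA hxB)
    exact hwa (hleaf C hC (fun e => hyA (e ▸ hyC)) w (hBA ▸ hwB) hwC)
  -- The cliques in `Q` lose at most one vertex in total when `Y` is removed.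
  have hloss : ∑ s ∈ Q, (q - (s \ Y).card) ≤ 1 := by
    have h1 : M.card + ∑ s ∈ Q, (s ∩ Y).card ≤ Y.card := by
      rw [← card_biUnion fun s hs t ht hst => disjoint_of_subset_left inter_subset_left
        (disjoint_of_subset_right inter_subset_left (hQd s hs t ht hst)),
        ← card_union_of_disjoint]
      · refine card_le_card (union_subset hMY (biUnion_subset.2 fun s _ => inter_subset_right))
      · rw [disjoint_biUnion_right]
        exact fun s hs => disjoint_of_subset_right inter_subset_left (hQ s hs).2.2
    have h2 : ∑ s ∈ Q, (s \ Y).card + ∑ s ∈ Q, (s ∩ Y).card = ∑ s ∈ Q, s.card := by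
      rw [← sum_add_distrib]
      exact sum_congr rfl fun s _ => card_sdiff_add_card_inter s Y
    have h3 : ∑ s ∈ Q, (q - (s \ Y).card) + ∑ s ∈ Q, (s \ Y).card = q * k := by
      rw [← sum_add_distrib, mul_comm, ← hQc]
      refine sum_const_nat fun s hs => Nat.sub_add_cancel ?_
      exact (card_le_card sdiff_subset).trans (hQ s hs).2.1
    omega
  have hone : ∀ s ∈ Q, q ≤ (s \ Y).card + 1 := by
    intro s hs
    have := single_le_sum (f := fun s => q - (s \ Y).card) (fun _ _ => Nat.zero_le _) hs
    omega
  have htwo : ∀ s ∈ Q, ∀ t ∈ Q, s ≠ t → 2 * q ≤ (s \ Y).card + (t \ Y).card + 1 := by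
    intro s hs t ht hst
    have hsub : ({s, t} : Finset (Finset V)) ⊆ Q := by
      intro r hr
      rcases mem_insert.1 hr with rfl | hr
      · exact hs
      · exact Finset.mem_singleton.1 hr ▸ ht
    have := sum_le_sum_of_subset (f := fun s => q - (s \ Y).card) hsub
    rw [sum_pair hst] at this
    omega
  have hex : ∀ s, ∃ B, s ∈ Q → B ∈ F ∧ s \ Y ⊆ B := by
    intro s
    by_cases hs : s ∈ Q
    · have hcl : (isolate G S).IsClique ((s \ Y : Finset V) : Set V) := by
        refine isClique_isolate ((hQ s hs).1.subset (by simp)) ?_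
        refine disjoint_of_subset_right ?_ sdiff_disjoint
        exact (subset_insert _ _).trans ((subset_insert _ _).trans (subset_insert _ _))
      obtain ⟨B, hB⟩ := hF.exists_subset (s \ Y) hcl (by have := hone s hs; omega)
      exact ⟨B, fun _ => hB⟩
    · exact ⟨∅, fun h => absurd h hs⟩
  choose β hβ using hex
  have hinj : Set.InjOn β Q := by
    intro s hs t ht hst
    by_contra hne
    have h1 := card_le_card (union_subset (hβ s hs).2 (hst ▸ (hβ t ht).2))
    rw [card_union_of_disjoint (disjoint_of_subset_left sdiff_subset
      (disjoint_of_subset_right sdiff_subset (hQd s hs t ht hne))), hF.size _ (hβ s hs).1] at h1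
    have := htwo s hs t ht hne
    omega
  have himg : Q.image β = F := by
    apply eq_of_subset_of_card_le
    · intro B hB
      obtain ⟨s, hs, rfl⟩ := mem_image.1 hB
      exact (hβ s hs).1
    · rw [card_image_of_injOn hinj, hQc, hF.card]
  obtain ⟨s, hs, hsA⟩ := mem_image.1 (himg ▸ hA)
  obtain ⟨t, ht, htA⟩ := mem_image.1 (himg ▸ hA')
  have hst : s ≠ t := fun e => hne (by rw [← hsA, ← htA, e])
  have hsm : ∀ (B s : Finset V) (z : V), B.card = q + 1 → s \ Y ⊆ B → a ∈ B → z ∈ B → z ≠ a →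
      z ∈ Y → (s \ Y).card ≤ q - 1 := by
    intro B s z hB hsB haB hzB hza hzY
    have hsub : s \ Y ⊆ (B.erase a).erase z := by
      intro w hw
      have hwY := (mem_sdiff.1 hw).2
      refine mem_erase.2 ⟨fun e => hwY (e ▸ hzY), mem_erase.2 ⟨fun e => hwY (e ▸ ?_), hsB hw⟩⟩
      simp [hY]
    have := card_le_card hsub
    rw [card_erase_of_mem (mem_erase.2 ⟨hza, hzB⟩), card_erase_of_mem haB, hB] at this
    omega
  have h1 := hsm A s x hA1 (hsA ▸ (hβ s hs).2) haA hxA hxa (by simp [hY])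
  have h2 := hsm A' t y hA1' (htA ▸ (hβ t ht).2) haA' hyA' hya (by simp [hY])
  have h3 := htwo s hs t ht hst
  omega

/-- A saturated graph has at least as many edges as the extremal graphs, and only the extremal
graphs attain equality. -/
theorem IsSaturated.sum_degree (h : IsSaturated (cliqueUnion p k q) G) (hp : 2 ≤ p)
    (hpq : p ≤ q) (hk : 0 < k) (hn : q * (q + 1) * k + 3 * (p - 2) < Fintype.card V) :
    extremalDegreeSum p q k (Fintype.card V) ≤ ∑ x, G.degree x ∧
      (∑ x, G.degree x = extremalDegreeSum p q k (Fintype.card V) →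
        ∃ S F, IsExtremal G p q k S F) := by
  by_cases hδ : ∀ u, p - 2 < G.degree u
  · have := h.lt_sum_degree hp hpq hk hn hδ
    exact ⟨this.le, fun e => absurd e this.ne'⟩
  push Not at hδ
  obtain ⟨v, hv⟩ := hδ
  have hn' : p - 1 < Fintype.card V := by
    have : q * 1 ≤ q * (q + 1) * k := by
      rw [mul_assoc]
      exact Nat.mul_le_mul_left q (Nat.mul_pos (Nat.succ_pos q) hk)
    omega
  have hv : G.degree v = p - 2 := by
    refine hv.antisymm ?_
    obtain ⟨u, -, hu⟩ : ∃ u ∈ (univ : Finset V), u ∉ closedNbhd G v := by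
      apply exists_mem_notMem_of_card_lt_card
      rw [card_closedNbhd, card_univ]
      omega
    rw [mem_closedNbhd, not_or] at hu
    obtain ⟨T, hT, hTa⟩ := h.exists_common_clique (by omega) hpq (Ne.symm hu.1) hu.2
    rw [← hT.card_eq, ← card_neighborFinset_eq_degree]
    exact card_le_card fun x hx => (mem_neighborFinset ..).2 (hTa x hx).1
  set S := G.neighborFinset v with hSd
  have hSc : S.card = p - 2 := by rw [hSd, card_neighborFinset_eq_degree, hv]
  have hS : ∀ x ∈ S, ∀ y, x ≠ y → G.Adj x y := fun x hx y hxy =>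
    h.adj_of_adj hp hpq hn' hv ((mem_neighborFinset ..).1 hx) hxy
  have hcrit := h.isCritical hp hpq hn' hv
  rw [← hSd] at hcrit
  have hq : 3 ≤ q ∨ q = 2 ∧ ∀ x y z, (isolate G S).Adj x y → (isolate G S).Adj y z → x ≠ z →
      (isolate G S).Adj x z := by
    rcases Nat.lt_or_ge 2 q with hq | hq
    · exact Or.inl hq
    · obtain rfl : q = 2 := by omega
      obtain rfl : p = 2 := by omega
      refine Or.inr ⟨rfl, hcrit.trans fun x z hxz hadj => ?_⟩
      have hS0 : S = ∅ := card_eq_zero.1 hSc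
      have hG : isolate G S = G := by
        ext x y
        simp [hS0]
      rw [hG] at hadj ⊢
      obtain ⟨M, F, hxM, hzM, -, hM, hM', hFc, hF, hFd, hsum⟩ :=
        h.exists_cliques (by omega) le_rfl hxz hadj
      have hsz : ∀ s ∈ F, s.card = 2 := by
        have hs : ∑ s ∈ F, s.card = ∑ s ∈ F, 2 := by
          rw [sum_const, hFc, smul_eq_mul, mul_comm]
          omega
        exact (sum_eq_sum_iff_of_le fun s hs => (hF s hs).2.1).1 hs
      exact ⟨F, ⟨fun s hs => ⟨(hF s hs).1, hsz s hs⟩, hFd, hFc⟩, fun s hs =>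
        ⟨Finset.disjoint_left.1 (hF s hs).2.2 hxM, Finset.disjoint_left.1 (hF s hs).2.2 hzM⟩⟩
  have : Nonempty V := ⟨v⟩
  obtain ⟨hle, heq⟩ := hcrit.sum_degree hq
  rw [sum_degree_eq_add_sum_isolate hS, hSc, extremalDegreeSum]
  refine ⟨Nat.add_le_add_left hle _, fun e => ?_⟩
  obtain ⟨F, hF⟩ := heq (Nat.add_left_cancel e)
  refine ⟨S, F, hSc, hF.card, hF.size, h.disjoint_of_isCliqueForest hp hpq hv hq hF,
    fun A hA => disjoint_of_isolate (hF.isClique hA) (by rw [hF.size A hA]; omega), ?_⟩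
  intro x y
  constructor
  · intro hxy
    refine ⟨hxy.ne, ?_⟩
    by_cases hxS : x ∈ S
    · exact Or.inl hxS
    by_cases hyS : y ∈ S
    · exact Or.inr (Or.inl hyS)
    · exact Or.inr (Or.inr ((hF.adj x y).1 ⟨hxy, hxS, hyS⟩).2)
  · rintro ⟨hne, hxS | hyS | hex⟩
    · exact hS x hxS y hne
    · exact (hS y hyS x hne.symm).symm
    · exact ((hF.adj x y).2 ⟨hne, hex⟩).1

end Extremal

section Isomorphism

open scoped Classical

variable {V : Type*} {G : SimpleGraph V} {p q k c : ℕ} {S : Finset V}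
  {F : Finset (Finset V)}

/-! ### Isomorphism with the join graph -/

theorem IsExtremal.nonempty_iso [Fintype V] (h : IsExtremal G p q k S F)
    (hc : p - 2 + (k * (q + 1) + c) = Fintype.card V) :
    Nonempty (G ≃g joinGraph (p - 2) k (q + 1) c) := by
  set R := (S ∪ F.biUnion id)ᶜ with hR
  have hFc : (F.biUnion id).card = k * (q + 1) := by
    rw [card_biUnion (t := id) fun A hA B hB hAB => h.disj A hA B hB hAB, ← h.card]
    exact sum_const_nat h.size
  have hSF : Disjoint S (F.biUnion id) := by
    rw [disjoint_biUnion_right]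
    exact fun A hA => (h.disj_core A hA).symm
  have hRc : R.card = c := by
    have := card_compl_add_card (S ∪ F.biUnion id)
    rw [card_union_of_disjoint hSF, hFc, h.card_core] at this
    rw [hR]
    omega
  have hRm : ∀ x ∈ R, x ∉ S ∧ ∀ A ∈ F, x ∉ A := by
    intro x hx
    simpa [hR] using hx
  set eS : Fin (p - 2) ≃ S := (equivFinOfCardEq h.card_core).symm
  set eF : Fin k ≃ F := (equivFinOfCardEq h.card).symm
  set eA : ∀ A : F, Fin (q + 1) ≃ A.1 := fun A => (equivFinOfCardEq (h.size A.1 A.2)).symm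
  set eR : Fin c ≃ R := (equivFinOfCardEq hRc).symm
  set f : Fin (p - 2) ⊕ (Fin k × Fin (q + 1) ⊕ Fin c) → V :=
    Sum.elim (fun i => (eS i).1) (Sum.elim (fun x => (eA (eF x.1) x.2).1) fun i => (eR i).1)
  have hSm : ∀ i, (eS i).1 ∈ S := fun i => (eS i).2
  have hAm : ∀ i j, (eA (eF i) j).1 ∈ (eF i).1 := fun i j => (eA (eF i) j).2
  have hRm' : ∀ i, (eR i).1 ∈ R := fun i => (eR i).2
  have hAS : ∀ i j, (eA (eF i) j).1 ∉ S := fun i j =>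
    Finset.disjoint_left.1 (h.disj_core _ (eF i).2) (hAm i j)
  have heF : ∀ i i' x, x ∈ (eF i).1 → x ∈ (eF i').1 → i = i' := by
    intro i i' x hx hx'
    apply eF.injective
    apply Subtype.ext
    by_contra hne
    exact Finset.disjoint_left.1 (h.disj _ (eF i).2 _ (eF i').2 hne) hx hx'
  have hf : Function.Injective f := by
    rintro (i | ⟨i, j⟩ | i) (i' | ⟨i', j'⟩ | i') he
    · have he : (eS i).1 = (eS i').1 := he
      rw [eS.injective (Subtype.ext he)]
    · have he : (eS i).1 = (eA (eF i') j').1 := he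
      exact absurd (he ▸ hSm i) (hAS i' j')
    · have he : (eS i).1 = (eR i').1 := he
      exact absurd (he ▸ hSm i) (hRm _ (hRm' i')).1
    · have he : (eA (eF i) j).1 = (eS i').1 := he
      exact absurd (he ▸ hSm i') (hAS i j)
    · have he : (eA (eF i) j).1 = (eA (eF i') j').1 := he
      obtain rfl := heF i i' _ (hAm i j) (he ▸ hAm i' j')
      rw [(eA (eF i)).injective (Subtype.ext he)]
    · have he : (eA (eF i) j).1 = (eR i').1 := he
      exact absurd (he ▸ hAm i j) ((hRm _ (hRm' i')).2 _ (eF i).2)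
    · have he : (eR i).1 = (eS i').1 := he
      exact absurd (he ▸ hSm i') (hRm _ (hRm' i)).1
    · have he : (eR i).1 = (eA (eF i') j').1 := he
      exact absurd (he ▸ hAm i' j') ((hRm _ (hRm' i)).2 _ (eF i').2)
    · have he : (eR i).1 = (eR i').1 := he
      rw [eR.injective (Subtype.ext he)]
  have hb : Function.Bijective f := by
    rw [Fintype.bijective_iff_injective_and_card]
    refine ⟨hf, ?_⟩
    simpa using hc
  refine ⟨RelIso.symm ⟨Equiv.ofBijective f hb, ?_⟩⟩
  intro a b
  show G.Adj (f a) (f b) ↔ _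
  rw [h.adj, hf.ne_iff]
  rcases a with i | ⟨i, j⟩ | i <;> rcases b with i' | ⟨i', j'⟩ | i'
  · exact ⟨fun hx => fun e => hx.1 (e ▸ rfl), fun hx =>
      ⟨fun e => (show i ≠ i' from hx) (Sum.inl.inj e), Or.inl (hSm i)⟩⟩
  · exact ⟨fun _ => trivial, fun _ => ⟨by simp, Or.inl (hSm i)⟩⟩
  · exact ⟨fun _ => trivial, fun _ => ⟨by simp, Or.inl (hSm i)⟩⟩
  · exact ⟨fun _ => trivial, fun _ => ⟨by simp, Or.inr (Or.inl (hSm i'))⟩⟩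
  · constructor
    · rintro ⟨hne, hS | hS | ⟨A, hA, hx, hy⟩⟩
      · exact absurd hS (hAS i j)
      · exact absurd hS (hAS i' j')
      · obtain ⟨l, hl⟩ := eF.surjective ⟨A, hA⟩
        have h1 := heF i l _ (hAm i j) (by rw [hl]; exact hx)
        have h2 := heF i' l _ (hAm i' j') (by rw [hl]; exact hy)
        obtain rfl := h1.trans h2.symm
        refine ⟨rfl, ?_⟩
        show j ≠ j'
        rintro rfl
        exact hne rfl
    · rintro ⟨hi, hj⟩
      have hi : i = i' := hi
      subst hi
      refine ⟨fun e => (show j ≠ j' from hj) ?_, Or.inr (Or.inr ⟨_, (eF i).2, hAm i j, hAm i j'⟩)⟩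
      simpa using e
  · refine ⟨fun hx => ?_, fun hx => absurd hx Bool.false_ne_true⟩
    rcases hx.2 with hS | hS | ⟨A, hA, -, hy⟩
    · exact absurd hS (hAS i j)
    · exact absurd hS (hRm _ (hRm' i')).1
    · exact absurd hy ((hRm _ (hRm' i')).2 A hA)
  · exact ⟨fun _ => trivial, fun _ => ⟨by simp, Or.inr (Or.inl (hSm i'))⟩⟩
  · refine ⟨fun hx => ?_, fun hx => absurd hx Bool.false_ne_true⟩
    rcases hx.2 with hS | hS | ⟨A, hA, hx, -⟩
    · exact absurd hS (hRm _ (hRm' i)).1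
    · exact absurd hS (hAS i' j')
    · exact absurd hx ((hRm _ (hRm' i)).2 A hA)
  · refine ⟨fun hx => ?_, fun hx => hx.elim⟩
    rcases hx.2 with hS | hS | ⟨A, hA, hx, -⟩
    · exact absurd hS (hRm _ (hRm' i)).1
    · exact absurd hS (hRm _ (hRm' i')).1
    · exact absurd hx ((hRm _ (hRm' i)).2 A hA)

theorem isExtremal_of_iso (e : G ≃g joinGraph (p - 2) k (q + 1) c) :
    ∃ S F, IsExtremal G p q k S F := by
  set block : Fin k → Finset V := fun i => univ.image fun j => e.symm (Sum.inr (Sum.inl (i, j)))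
    with hblock
  have hinj : Function.Injective e.symm := e.symm.injective
  have hbc : ∀ i, (block i).card = q + 1 := by
    intro i
    rw [hblock, card_image_of_injective _ fun a b hab => by simpa using hinj hab]
    simp
  have hbm : ∀ i y, e.symm y ∈ block i ↔ ∃ j, y = Sum.inr (Sum.inl (i, j)) := by
    intro i y
    simp only [hblock, mem_image, mem_univ, true_and]
    exact exists_congr fun j => ⟨fun h => (hinj h).symm, fun h => h ▸ rfl⟩
  have hsm : ∀ y, e.symm y ∈ univ.image (fun i => e.symm (Sum.inl i)) ↔ ∃ i, y = Sum.inl i := by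
    intro y
    simp only [mem_image, mem_univ, true_and]
    exact exists_congr fun j => ⟨fun h => (hinj h).symm, fun h => h ▸ rfl⟩
  have hbd : ∀ i i', i ≠ i' → Disjoint (block i) (block i') := by
    intro i i' hii
    rw [Finset.disjoint_left]
    intro x hx hx'
    obtain ⟨y, rfl⟩ := e.symm.surjective x
    obtain ⟨j, rfl⟩ := (hbm i y).1 hx
    obtain ⟨j', hj'⟩ := (hbm i' _).1 hx'
    simp only [Sum.inr.injEq, Sum.inl.injEq, Prod.mk.injEq] at hj'
    exact hii hj'.1
  refine ⟨univ.image fun i => e.symm (Sum.inl i), univ.image block, ?_, ?_, ?_, ?_, ?_, ?_⟩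
  · rw [card_image_of_injective _ fun a b hab => by simpa using hinj hab]
    simp
  · rw [card_image_of_injective]
    · simp
    · intro i i' hii
      by_contra hne
      have h0 := hbd i i' hne
      rw [hii, disjoint_self] at h0
      have h1 := hbc i'
      rw [show block i' = ∅ from h0, card_empty] at h1
      omega
  · intro A hA
    obtain ⟨i, -, rfl⟩ := mem_image.1 hA
    exact hbc i
  · intro A hA B hB hAB
    obtain ⟨i, -, rfl⟩ := mem_image.1 hA
    obtain ⟨i', -, rfl⟩ := mem_image.1 hB
    exact hbd i i' fun h => hAB (h ▸ rfl)
  · intro A hA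
    obtain ⟨i, -, rfl⟩ := mem_image.1 hA
    rw [Finset.disjoint_left]
    intro x hx hx'
    obtain ⟨y, rfl⟩ := e.symm.surjective x
    obtain ⟨j, rfl⟩ := (hbm i y).1 hx
    obtain ⟨j', hj'⟩ := (hsm _).1 hx'
    simp at hj'
  · intro x y
    obtain ⟨a, rfl⟩ := e.symm.surjective x
    obtain ⟨b, rfl⟩ := e.symm.surjective y
    rw [e.symm.map_adj_iff, hsm, hsm, hinj.ne_iff]
    simp only [mem_image, mem_univ, true_and, exists_exists_eq_and, hbm]
    rcases a with i | ⟨i, j⟩ | i <;> rcases b with i' | ⟨i', j'⟩ | i'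
    · exact ⟨fun h => ⟨fun e => (show i ≠ i' from h) (Sum.inl.inj e), Or.inl ⟨i, rfl⟩⟩,
        fun h e => h.1 (e ▸ rfl)⟩
    · simp [joinGraph, join]
    · simp [joinGraph, join]
    · simp [joinGraph, join]
    · simp [joinGraph, join, copies]
      tauto
    · simp [joinGraph, join]
    · simp [joinGraph, join]
    · simp [joinGraph, join]
    · simp [joinGraph, join]

/-! ### The saturation number -/

theorem two_mul_ncard_edgeSet [Fintype V] (G : SimpleGraph V) :
    2 * G.edgeSet.ncard = ∑ x, G.degree x := by
  rw [sum_degrees_eq_twice_card_edges, ← coe_edgeFinset, Set.ncard_coe_finset]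

end Isomorphism

/-- Twice the saturation number is the degree sum of the extremal graphs. -/
theorem two_mul_sat {p q k n : ℕ} (hp : 2 ≤ p) (hpq : p ≤ q) (hk : 0 < k)
    (hn : q * (q + 1) * k + 3 * (p - 2) < n) (hc : p - 2 + (k * (q + 1) + c) = n) :
    2 * sat n (cliqueUnion p k q) = extremalDegreeSum p q k n := by
  classical
  have hJ : Fintype.card (Fin (p - 2) ⊕ (Fin k × Fin (q + 1) ⊕ Fin c)) = n := by simpa using hc
  obtain ⟨S, F, hE⟩ := isExtremal_of_iso
    ((joinGraph (p - 2) k (q + 1) c).overFinIso hJ).symm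
  have hmem := two_mul_ncard_edgeSet ((joinGraph (p - 2) k (q + 1) c).overFin hJ)
  have hE' := hE.sum_degree
  have hle : ∀ m ∈ {m : ℕ | ∃ G : SimpleGraph (Fin n),
      IsSaturated (cliqueUnion p k q) G ∧ G.edgeSet.ncard = m},
      extremalDegreeSum p q k n ≤ 2 * m := by
    rintro m ⟨G, hG, rfl⟩
    rw [two_mul_ncard_edgeSet]
    have := (hG.sum_degree hp hpq hk (by rwa [Fintype.card_fin])).1
    rwa [Fintype.card_fin] at this
  rw [Fintype.card_fin] at hE'
  apply le_antisymm
  · rw [← hE', ← hmem]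
    exact Nat.mul_le_mul_left 2 (Nat.sInf_le ⟨_, hE.isSaturated hp hpq, rfl⟩)
  · exact hle _ (Nat.sInf_mem ⟨_, _, hE.isSaturated hp hpq, rfl⟩)

end CliqueSat

/-- The natural-number subtractions below never truncate under the hypotheses. -/
theorem theorem1 (p q t n : ℕ) (hp : 2 ≤ p) (hpq : p ≤ q) (ht : 2 ≤ t)
    (hn : q * (q + 1) * (t - 1) + 3 * (p - 2) < n)
    {V : Type*} (G : SimpleGraph V) :
    CliqueSat.IsMinSaturated n (CliqueSat.cliqueUnion p (t - 1) q) G ↔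
      Nonempty (G ≃g CliqueSat.joinGraph (p - 2) (t - 1) (q + 1)
        (n + 3 - (t + p + q * (t - 1)))) := by
  have hk : 0 < t - 1 := by omega
  have hc : p - 2 + ((t - 1) * (q + 1) + (n + 3 - (t + p + q * (t - 1)))) = n := by
    obtain ⟨k, rfl⟩ : ∃ k, t = k + 1 := ⟨t - 1, by omega⟩
    rw [Nat.add_sub_cancel] at hn hk ⊢
    have h1 : 1 * (q * k) ≤ q * (q * k) := Nat.mul_le_mul_right _ (by omega)
    have h2 : q * (q + 1) * k = q * (q * k) + q * k := by ring
    have h3 : k * (q + 1) = q * k + k := by ring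
    have h4 : 1 * k ≤ q * k := Nat.mul_le_mul_right _ (by omega)
    omega
  have hsat := CliqueSat.two_mul_sat hp hpq hk hn hc
  constructor
  · rintro ⟨hfin, hcard, hG, hedges⟩
    have := Fintype.ofFinite V
    rw [Nat.card_eq_fintype_card] at hcard
    subst hcard
    have hsum := CliqueSat.two_mul_ncard_edgeSet G
    rw [hedges, hsat] at hsum
    obtain ⟨S, F, hE⟩ := (hG.sum_degree hp hpq hk hn).2 hsum.symm
    exact hE.nonempty_iso hc
  · rintro ⟨e⟩
    have hfin : Finite V := Finite.of_equiv _ e.toEquiv.symm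
    have := Fintype.ofFinite V
    have hcard : Fintype.card V = n := by
      rw [Fintype.card_congr e.toEquiv]
      simpa using hc
    obtain ⟨S, F, hE⟩ := CliqueSat.isExtremal_of_iso e
    refine ⟨hfin, by rw [Nat.card_eq_fintype_card, hcard], hE.isSaturated hp hpq, ?_⟩
    have h1 := CliqueSat.two_mul_ncard_edgeSet G
    rw [hE.sum_degree, hcard] at h1
    omega
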